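/- Let $\mathbb T=\{t\in\mathbb C: |t|=1\}$ be identified with $\mathbb R/\mathbb Z$ via $\theta\mapsto e^{2\pi i\theta}$, let $m$ be Lebesgue measure on $\mathbb T$ normalized by $m(\mathbb T)=1$, and let $\operatorname{dist}$ be the distance of $\mathbb R/\mathbb Z$. For a finite positive measure $\rho$ on $\mathbb T$ and $n\ge 1$ put $$e_n(\rho)=\min_{q_0,\dots,q_{n-1}\in\mathbb C}\Bigl(\int_{\mathbb T}\bigl|q_0+q_1t+\dots+q_{n-1}t^{n-1}+t^n\bigr|^2\,d\rho(t)\Bigr)^{1/2}.$$ Let $\nu>0$, $\vartheta=\frac{\nu}{\nu+1}$ and $p>\vartheta$. Let $K=\{\exp(2\pi i k^{-\nu}): k=1,2,3,\dots\}\cup\{1\}\subset\mathbb T$, let $d_K(t)=\operatorname{dist}(t,K)$, and let $d\rho=\exp(-d_K^{-p})\,dm$ (the density being $0$ on $K$). Then there are constants $0<c\le C<\infty$, depending only on $\nu$ and $p$, such that for all $n\ge 1$ $$c\,n^{\frac{p-\vartheta}{p+\vartheta}}\le|\log e_n(\rho)|\le C\,n^{\frac{p-\vartheta}{p+\vartheta}}.$$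 -/

import Mathlib

open MeasureTheory

noncomputable section

/-- The circle `𝕋` is identified with `ℝ / ℤ` (`UnitAddCircle`, with its quotient metric and with
`volume` the Lebesgue measure of total mass `1`) by `θ ↦ exp (2 π i θ)`. This is the complex
number of modulus one that corresponds to a point of `ℝ / ℤ`. -/
def circlePoint (t : UnitAddCircle) : ℂ := (AddCircle.toCircle t : ℂ)

/-- The prediction error `e_n(ρ)`: the distance in `L²(ρ)` from `tⁿ` to the polynomials
`q₀ + q₁ t + ⋯ + q_{n-1} t^{n-1}` with complex coefficients, for a finite measure `ρ`. -/
def predictionError (ρ : Measure UnitAddCircle) (n : ℕ) : ℝ :=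
  ⨅ q : Fin n → ℂ, Real.sqrt
    (∫ t, ‖(∑ j : Fin n, q j * circlePoint t ^ (j : ℕ)) + circlePoint t ^ n‖ ^ 2 ∂ρ)

/-- The compact set `K = {exp (2 π i k^{-ν}) : k = 1, 2, …} ∪ {1}` on the circle. -/
def powerSeqSet (ν : ℝ) : Set UnitAddCircle :=
  {t | (∃ k : ℕ, 1 ≤ k ∧
      circlePoint t = Complex.exp (2 * Real.pi * Complex.I * (((k : ℝ) ^ (-ν) : ℝ) : ℂ))) ∨
    circlePoint t = 1}

/-- The density `exp (-d_K^{-p})`, where `d_K (t) = dist (t, K)`, for `p > 0`;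
at distance zero `d_K^{-p} = +∞`, and the density is `0`. -/
def deepZeroDensity (K : Set UnitAddCircle) (p : ℝ) (t : UnitAddCircle) : ℝ :=
  if Metric.infDist t K = 0 then 0 else Real.exp (-(Metric.infDist t K) ^ (-p))

/-- The measure `dρ = exp (-d_K^{-p}) dm`. -/
def deepZeroMeasure (K : Set UnitAddCircle) (p : ℝ) : Measure UnitAddCircle :=
  volume.withDensity fun t => ENNReal.ofReal (deepZeroDensity K p t)

end

/-! Write θ for ν/(ν+1). The δ-neighbourhood of K has measure ε of order δ^θ, and conversely K is
νε^(1/θ)-dense in the arc [0, ε]. With δ of order n^(-1/(p+θ)), the quantities nε², εδ^(-p) and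
δ^(θ-p) all have the order n^((p-θ)/(p+θ)).

Bound of `e_n` from below: for monic P, Jensen gives ∫ log|P|² ≥ 0. Let Y ≤ 1 be positive with ∫|P|²
dρ ≤ Y. Off the δ-neighbourhood E, log|P|² is at most d_K^(-p) + log Y + |P|²W/Y, where W is the
density. On E the weight gives nothing, but a Remez inequality with sharp exponential order in εn
carries the bound from outside E into E, so log|P|² is at most δ^(-p) + log(1/ε) + O(εn) there.
Integrating bounds -log Y by a multiple of ∫ d_K^(-p) + 1 + ε(δ^(-p) + log(1/ε) + εn)
(`exp_neg_le_integral_norm_sq_mul`, `norm_sq_eval_circlePoint_le`).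

Bound from above: take the monic Chebyshev polynomial of the complement of the arc [0, ε]. Its
square is of order exp(-nε²) off the arc and at most of order exp(πnε) on it, where the weight is
below exp(-(νε^(1/θ))^(-p)). For ε a small multiple of n^(-θ/(p+θ)) the weight wins
(`predictionError_powerSeqSet_le_sqrt`). -/

/-! ### Remez inequality on an interval, through Chebyshev nodes. -/

open Polynomial Polynomial.Chebyshev Finset in
theorem eval_eq_sum_eval_mul_prod_div {n : ℕ} {v : ℕ → ℝ} (hv : Set.InjOn v (range (n + 1)))
    {p : ℝ[X]} (hp : p.natDegree ≤ n) (x : ℝ) :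
    p.eval x = ∑ i ∈ range (n + 1), p.eval (v i) *
      ∏ j ∈ (range (n + 1)).erase i, (x - v j) / (v i - v j) := by
  have hd : p.degree < #(range (n + 1)) := by
    rw [card_range]
    exact lt_of_le_of_lt degree_le_natDegree (by exact_mod_cast Nat.lt_succ_of_le hp)
  conv_lhs => rw [Lagrange.eq_interpolate hv hd, Lagrange.interpolate_eq_sum]
  simp only [eval_finsetSum, eval_mul, eval_C, eval_prod, eval_sub, eval_X]
  refine sum_congr rfl fun i _ => ?_
  rw [prod_div_distrib]
  ring

open Polynomial Polynomial.Chebyshev Finset in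
/-- The Lagrange functional of the Chebyshev nodes at a point `y ≥ 1` has norm `T_n y`. -/
theorem sum_prod_node_eq_eval_T {n : ℕ} (y : ℝ) (hy : 1 ≤ y) :
    ∑ i ∈ range (n + 1), ∏ j ∈ (range (n + 1)).erase i, |(y - node n j) / (node n i - node n j)| =
      (T ℝ n).eval y := by
  -- Interpolate T_n itself: its values (-1)^i at the nodes cancel the signs of the Lagrange
  -- denominators, so every term equals its modulus.
  rw [eval_eq_sum_eval_mul_prod_div (strictAntiOn_node n).injOn (p := T ℝ n) (n := n)
    (by simp) y]
  refine sum_congr rfl fun i hi => ?_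
  rw [eval_T_real_node (by simpa [Nat.lt_succ_iff] using hi), prod_div_distrib]
  simp only [abs_div, prod_div_distrib]
  have h1 : ∏ j ∈ (range (n + 1)).erase i, |y - node n j| =
      ∏ j ∈ (range (n + 1)).erase i, (y - node n j) :=
    prod_congr rfl fun j _ => abs_of_nonneg (by linarith [(node_mem_Icc (n := n) (i := j)).2])
  have h2 : ∏ j ∈ (range (n + 1)).erase i, |node n i - node n j| =
      (-1) ^ i * ∏ j ∈ (range (n + 1)).erase i, (node n i - node n j) := by
    have := zero_lt_prod_node_sub_node (n := n) (i := i) (by simpa [Nat.lt_succ_iff] using hi)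
    rw [← abs_prod, ← abs_of_pos this, abs_mul, abs_neg_one_pow, one_mul]
  rw [h1, h2]
  rcases neg_one_pow_eq_or ℝ i with h | h <;> rw [h] <;> simp [div_neg]

open Polynomial Polynomial.Chebyshev Finset in
/-- Interpolation nodes that are spread at least as much, in ratio, as the Chebyshev nodes seen
from `y` give a bound at the origin by the value of the Chebyshev polynomial at `y`. -/
theorem abs_eval_zero_le_eval_T {n : ℕ} {p : ℝ[X]} (hp : p.natDegree ≤ n) {A y : ℝ} (hy : 1 < y)
    {u : ℕ → ℝ} (hu0 : ∀ i ≤ n, 0 < u i)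
    (hu : ∀ i j, i < j → j ≤ n → (y - node n j) / (y - node n i) ≤ u j / u i)
    (hA : ∀ i ≤ n, |p.eval (u i)| ≤ A) :
    |p.eval 0| ≤ A * (T ℝ n).eval y := by
  have hA0 : 0 ≤ A := (abs_nonneg _).trans (hA 0 (Nat.zero_le _))
  have hv0 : ∀ i, 0 < y - node n i := fun i => by linarith [(node_mem_Icc (n := n) (i := i)).2]
  have hratio : ∀ i j, i < j → j ≤ n → 1 < (y - node n j) / (y - node n i) := fun i j hij hj => by
    rw [one_lt_div (hv0 i)]
    linarith [node_lt hj hij]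
  have hlt : ∀ i j, i < j → j ≤ n → u i < u j := fun i j hij hj => by
    have := (hratio i j hij hj).trans_le (hu i j hij hj)
    rwa [one_lt_div (hu0 i (by omega))] at this
  have hmono : StrictMonoOn u (range (n + 1)) := fun i hi j hj hij => by
    simp only [coe_range, Set.mem_Iio] at hj
    exact hlt i j hij (by omega)
  rw [eval_eq_sum_eval_mul_prod_div hmono.injOn hp 0, ← sum_prod_node_eq_eval_T y hy.le, mul_sum]
  refine (abs_sum_le_sum_abs _ _).trans (sum_le_sum fun i hi => ?_)
  rw [abs_mul, abs_prod]
  have hin : i ≤ n := by simpa [Nat.lt_succ_iff] using hi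
  -- A Lagrange factor at 0 depends only on the ratio ρ > 1 of the two nodes, as ρ/(ρ-1) or 1/(ρ-1).
  -- Both decrease in ρ, so the comparison holds factor by factor.
  refine mul_le_mul (hA i hin) (prod_le_prod (fun _ _ => abs_nonneg _) fun j hj => ?_)
    (prod_nonneg fun _ _ => abs_nonneg _) hA0
  have hjn : j ≤ n := by
    have := (mem_erase.mp hj).2
    simpa [Nat.lt_succ_iff] using this
  have hji := (mem_erase.mp hj).1
  rcases lt_or_gt_of_ne hji with h | h
  · have h1 := hu j i h hin
    have h2 := hlt j i h hin
    have h3 := node_lt hin h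
    rw [abs_div, abs_div, zero_sub, abs_neg, abs_of_pos (hu0 j hjn), abs_of_pos (hv0 j),
      abs_of_pos (by linarith : 0 < u i - u j), abs_of_neg (by linarith : node n i - node n j < 0),
      div_le_div_iff₀ (by linarith) (by linarith)]
    rw [div_le_div_iff₀ (hv0 j) (hu0 j hjn)] at h1
    nlinarith
  · have h1 := hu i j h hjn
    have h2 := hlt i j h hjn
    have h3 := node_lt hjn h
    rw [abs_div, abs_div, zero_sub, abs_neg, abs_of_pos (hu0 j hjn), abs_of_pos (hv0 j),
      abs_of_neg (by linarith : u i - u j < 0), abs_of_pos (by linarith : 0 < node n i - node n j),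
      div_le_div_iff₀ (by linarith) (by linarith)]
    rw [div_le_div_iff₀ (hv0 i) (hu0 i hin)] at h1
    nlinarith

-- The argument is cosh u with u = log((1+r)/(1-r)) ≤ 3r, and T_n(cosh u) = cosh(nu).
open Polynomial Polynomial.Chebyshev in
theorem eval_T_le_exp {n : ℕ} {r : ℝ} (hr0 : 0 ≤ r) (hr : r ≤ 1 / 2) :
    (T ℝ n).eval ((1 + r ^ 2) / (1 - r ^ 2)) ≤ Real.exp (3 * r * n) := by
  have h1 : 0 < 1 - r := by linarith
  have hx : 0 < (1 + r) / (1 - r) := by positivity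
  have hy : (1 + r ^ 2) / (1 - r ^ 2) = Real.cosh (Real.log ((1 + r) / (1 - r))) := by
    rw [Real.cosh_log hx]
    have : 1 - r ^ 2 = (1 - r) * (1 + r) := by ring
    rw [this]
    field_simp
    ring
  have hu0 : 0 ≤ Real.log ((1 + r) / (1 - r)) :=
    Real.log_nonneg (by rw [le_div_iff₀ h1]; linarith)
  have hu : Real.log ((1 + r) / (1 - r)) ≤ 3 * r := by
    rw [Real.log_div (by linarith) h1.ne']
    have e1 := Real.log_le_sub_one_of_pos (by linarith : 0 < 1 + r)
    have e2 := Real.one_sub_inv_le_log_of_pos h1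
    have e3 : (1 - r)⁻¹ ≤ 1 + 2 * r := by
      rw [inv_le_iff_one_le_mul₀ h1]
      nlinarith
    linarith
  rw [hy, T_real_cosh, Real.cosh_eq]
  have h2 : (n : ℝ) * Real.log ((1 + r) / (1 - r)) ≤ 3 * r * n := by
    rw [mul_comm]
    gcongr
  have h3 : Real.exp ((n : ℤ) * Real.log ((1 + r) / (1 - r))) ≤ Real.exp (3 * r * n) :=
    Real.exp_le_exp.mpr (by exact_mod_cast h2)
  have h4 : Real.exp (-((n : ℤ) * Real.log ((1 + r) / (1 - r)))) ≤ Real.exp (3 * r * n) := by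
    apply Real.exp_le_exp.mpr
    have : (0 : ℝ) ≤ (n : ℤ) * Real.log ((1 + r) / (1 - r)) := by positivity
    have : 0 ≤ 3 * r * n := by positivity
    linarith
  linarith

/-- On (0, π/2] the function log sin is increasing and concave, so moving a gap to the left or
widening it increases the ratio. Concavity enters as sin(a+d) sin b - sin(b+d) sin a = sin d
sin(b-a). -/
theorem sin_div_sin_le_sin_div_sin {a a' b b' : ℝ} (ha : 0 < a) (hab : a ≤ b) (hbb : b ≤ b')
    (hab' : a' ≤ b') (hd : b' - b ≤ a' - a) (hb' : b' ≤ Real.pi / 2) :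
    Real.sin b' / Real.sin b ≤ Real.sin a' / Real.sin a := by
  have hpi := Real.pi_pos
  have sa : 0 < Real.sin a := Real.sin_pos_of_pos_of_lt_pi ha (by linarith)
  have sb : 0 < Real.sin b := Real.sin_pos_of_pos_of_lt_pi (by linarith) (by linarith)
  have h1 : Real.sin (a + (b' - b)) ≤ Real.sin a' :=
    Real.sin_le_sin_of_le_of_le_pi_div_two (by linarith) (by linarith) (by linarith)
  have h2 : 0 ≤ Real.sin (b' - b) * Real.sin (b - a) :=
    mul_nonneg (Real.sin_nonneg_of_nonneg_of_le_pi (by linarith) (by linarith))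
      (Real.sin_nonneg_of_nonneg_of_le_pi (by linarith) (by linarith))
  rw [div_le_div_iff₀ sb sa]
  have h3 : Real.sin (a + (b' - b)) * Real.sin b - Real.sin b' * Real.sin a =
      Real.sin (b' - b) * Real.sin (b - a) := by
    have : Real.sin b' = Real.sin (b + (b' - b)) := by ring_nf
    rw [this, Real.sin_add a, Real.sin_add b, Real.sin_sub b a]
    ring
  nlinarith

/-- The map x ↦ |F ∩ [0, x]| is 1-Lipschitz, so it takes the value c. Retreating to the last point
of F before that place does not change the measure. -/
theorem exists_mem_measure_inter_Icc_eq {F : Set ℝ} (hF : IsClosed F) {L ε c : ℝ}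
    (hFε : volume.real (Set.Icc 0 L \ F) ≤ ε) (hc0 : 0 < c) (hc : c ≤ L - ε) :
    ∃ x ∈ F, 0 < x ∧ x ≤ c + ε ∧ volume.real (F ∩ Set.Icc 0 x) = c := by
  have hε : 0 ≤ ε := measureReal_nonneg.trans hFε
  set g : ℝ → ℝ := fun x => volume.real (F ∩ Set.Icc 0 x) with hg
  have hfin : ∀ x, volume (F ∩ Set.Icc 0 x) ≠ ⊤ := fun x =>
    measure_ne_top_of_subset Set.inter_subset_right (by simp)
  have hmono : Monotone g := fun x y hxy =>
    measureReal_mono (Set.inter_subset_inter_right _ (Set.Icc_subset_Icc_right hxy)) (hfin y)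
  have hlip : ∀ x y, x ≤ y → g y ≤ g x + (y - x) := fun x y hxy => by
    have h1 : F ∩ Set.Icc 0 y ⊆ (F ∩ Set.Icc 0 x) ∪ Set.Icc x y := fun z hz => by
      rcases le_total z x with h | h
      · exact Or.inl ⟨hz.1, hz.2.1, h⟩
      · exact Or.inr ⟨h, hz.2.2⟩
    have h2 := (measureReal_mono (μ := volume) h1
      (measure_union_ne_top (hfin x) (by simp))).trans (measureReal_union_le _ _)
    rwa [Real.volume_real_Icc_of_le hxy] at h2
  have hcont : Continuous g := by
    have : LipschitzWith 1 g := LipschitzWith.of_le_add fun x y => by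
      rcases le_total x y with h | h
      · exact (hmono h).trans (by linarith [dist_nonneg (x := x) (y := y)])
      · rw [Real.dist_eq, abs_of_nonneg (by linarith)]
        exact hlip y x h
    exact this.continuous
  have hsplit : ∀ x, 0 ≤ x → x ≤ L → x ≤ g x + ε := fun x hx hxL => by
    have h1 : Set.Icc 0 x ⊆ (F ∩ Set.Icc 0 x) ∪ (Set.Icc 0 L \ F) := fun z hz => by
      by_cases hzF : z ∈ F
      · exact Or.inl ⟨hzF, hz⟩
      · exact Or.inr ⟨⟨hz.1, hz.2.trans hxL⟩, hzF⟩
    have h2 := (measureReal_mono (μ := volume) h1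
      (measure_union_ne_top (hfin x) (measure_ne_top_of_subset Set.sdiff_subset (by simp)))).trans
      (measureReal_union_le _ _)
    rw [Real.volume_real_Icc_of_le hx] at h2
    change x ≤ volume.real (F ∩ Set.Icc 0 x) + ε
    linarith
  have hL : 0 ≤ L := by linarith
  have hg0 : g 0 ≤ 0 := by
    have : g 0 ≤ volume.real (Set.Icc (0 : ℝ) 0) :=
      measureReal_mono Set.inter_subset_right (by simp)
    exact this.trans (by simp [measureReal_def])
  obtain ⟨y, hy, hyc⟩ : c ∈ g '' Set.Icc 0 L :=
    intermediate_value_Icc hL hcont.continuousOn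
      ⟨by linarith, by linarith [hsplit L hL le_rfl]⟩
  have hcpt : IsCompact (F ∩ Set.Icc 0 y) := isCompact_Icc.inter_left hF
  have hne : (F ∩ Set.Icc 0 y).Nonempty := by
    rw [Set.nonempty_iff_ne_empty]
    intro h
    simp only [hg, h, measureReal_empty] at hyc
    linarith
  have hmem := hcpt.sSup_mem hne
  set x := sSup (F ∩ Set.Icc 0 y)
  have hxc : g x = c := by
    rw [← hyc]
    change volume.real _ = volume.real _
    congr 1
    ext z
    exact ⟨fun hz => ⟨hz.1, hz.2.1, hz.2.2.trans hmem.2.2⟩,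
      fun hz => ⟨hz.1, hz.2.1, le_csSup hcpt.bddAbove hz⟩⟩
  refine ⟨x, hmem.1, ?_, ?_, hxc⟩
  · by_contra h
    have := hmono (not_lt.mp h)
    linarith
  · have := hsplit x hmem.2.1 (hmem.2.2.trans hy.2)
    linarith

open Polynomial Polynomial.Chebyshev in
/-- A Remez inequality at the origin for polynomials in `sin² (π x)`. -/
theorem abs_eval_zero_le_of_abs_eval_sin_sq_le {n : ℕ} {p : ℝ[X]} (hp : p.natDegree ≤ n)
    {F : Set ℝ} (hF : IsClosed F) {ε A : ℝ} (hε0 : 0 < ε) (hε : ε ≤ 1 / 16)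
    (hFε : volume.real (Set.Icc 0 (1 / 2) \ F) ≤ ε)
    (hA : ∀ x ∈ F, |p.eval (Real.sin (Real.pi * x) ^ 2)| ≤ A) :
    |p.eval 0| ≤ A * Real.exp (6 * Real.pi * ε * n) := by
  have hpi := Real.pi_pos
  have hpi4 := Real.pi_lt_four
  set r := Real.sin (2 * Real.pi * ε) with hr
  have hr0 : 0 < r := Real.sin_pos_of_pos_of_lt_pi (by positivity) (by nlinarith)
  have hrle : r ≤ 2 * Real.pi * ε := Real.sin_le (by positivity)
  have hr2 : r ≤ 1 / 2 := by nlinarith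
  have hr21 : 0 < 1 - r ^ 2 := by nlinarith
  set y := (1 + r ^ 2) / (1 - r ^ 2) with hy
  have hy1 : 1 < y := by rw [hy, one_lt_div hr21]; nlinarith
  -- The Chebyshev nodes carried affinely to [r², 1]; the origin then corresponds to `y`.
  set v : ℕ → ℝ := fun j => (1 - r ^ 2) / 2 * (y - node n j) with hv
  have hyv : ∀ j, v j = (1 + r ^ 2) / 2 - (1 - r ^ 2) / 2 * node n j := fun j => by
    simp only [hv, hy]; field_simp
  have hvr : ∀ j, r ^ 2 ≤ v j := fun j => by
    rw [hyv]; nlinarith [(node_mem_Icc (n := n) (i := j)).2]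
  have hv1 : ∀ j, v j ≤ 1 := fun j => by
    rw [hyv]; nlinarith [(node_mem_Icc (n := n) (i := j)).1]
  have hvlt : ∀ i j, i < j → j ≤ n → v i < v j := fun i j hij hj => by
    simp only [hyv]; nlinarith [node_lt hj hij]
  have hv0 : ∀ j, 0 < v j := fun j => lt_of_lt_of_le (by positivity) (hvr j)
  set φ : ℕ → ℝ := fun j => Real.arcsin (Real.sqrt (v j)) with hφ
  have hsq1 : ∀ j, Real.sqrt (v j) ≤ 1 := fun j => Real.sqrt_le_one.mpr (hv1 j)
  have hsin : ∀ j, Real.sin (φ j) = Real.sqrt (v j) := fun j =>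
    Real.sin_arcsin (by linarith [Real.sqrt_nonneg (v j)]) (hsq1 j)
  have hφr : ∀ j, 2 * Real.pi * ε ≤ φ j := fun j => by
    rw [hφ, Real.le_arcsin_iff_sin_le ⟨by nlinarith, by nlinarith⟩
      ⟨by linarith [Real.sqrt_nonneg (v j)], hsq1 j⟩]
    exact Real.le_sqrt_of_sq_le (hvr j)
  have hφle : ∀ j, φ j ≤ Real.pi / 2 := fun j => Real.arcsin_le_pi_div_two _
  have hφlt : ∀ i j, i < j → j ≤ n → φ i ≤ φ j := fun i j hij hj =>
    Real.monotone_arcsin (Real.sqrt_le_sqrt (hvlt i j hij hj).le)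
  -- The points `x j` of F are chosen by the measure of F to their left, not by position. Hence π`x
  -- j` ≤ `φ j`, while gaps between the π`x j` are at least those between the `φ j`, as the ratio
  -- comparison needs. Since r = sin 2πε, each prescribed measure is at least ε > 0.
  have hex : ∀ j, ∃ x ∈ F, 0 < x ∧ x ≤ φ j / Real.pi ∧
      volume.real (F ∩ Set.Icc 0 x) = φ j / Real.pi - ε := fun j => by
    have h1 : 2 * ε ≤ φ j / Real.pi := by rw [le_div_iff₀ hpi]; linarith [hφr j]
    have h2 : φ j / Real.pi ≤ 1 / 2 := by rw [div_le_iff₀ hpi]; linarith [hφle j]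
    obtain ⟨x, hx, hx0, hxc, hxe⟩ := exists_mem_measure_inter_Icc_eq hF hFε
      (c := φ j / Real.pi - ε) (by linarith) (by linarith)
    exact ⟨x, hx, hx0, by linarith, hxe⟩
  choose x hxF hx0 hxle hxg using hex
  have hxle' : ∀ j, Real.pi * x j ≤ φ j := fun j => by
    have := hxle j
    rw [le_div_iff₀ hpi] at this
    linarith
  have hxd : ∀ i j, i < j → j ≤ n → φ j - φ i ≤ Real.pi * x j - Real.pi * x i := by
    intro i j hij hj
    rcases le_total (x i) (x j) with h | h
    · have h1 : F ∩ Set.Icc 0 (x j) ⊆ (F ∩ Set.Icc 0 (x i)) ∪ Set.Icc (x i) (x j) := fun z hz => by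
        rcases le_total z (x i) with h | h
        · exact Or.inl ⟨hz.1, hz.2.1, h⟩
        · exact Or.inr ⟨h, hz.2.2⟩
      have h2 := (measureReal_mono (μ := volume) h1
        (measure_union_ne_top (measure_ne_top_of_subset Set.inter_subset_right (by simp))
          (by simp))).trans (measureReal_union_le _ _)
      rw [Real.volume_real_Icc_of_le h, hxg, hxg] at h2
      have h3 : (φ j - φ i) / Real.pi ≤ x j - x i := by rw [sub_div]; linarith
      rw [div_le_iff₀ hpi] at h3
      linarith
    · have h1 : F ∩ Set.Icc 0 (x j) ⊆ F ∩ Set.Icc 0 (x i) :=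
        Set.inter_subset_inter_right _ (Set.Icc_subset_Icc_right h)
      have h2 := measureReal_mono (μ := volume) h1
        (measure_ne_top_of_subset Set.inter_subset_right (by simp))
      rw [hxg, hxg] at h2
      have h3 : φ j / Real.pi ≤ φ i / Real.pi := by linarith
      rw [div_le_div_iff_of_pos_right hpi] at h3
      have h4 : Real.sqrt (v i) < Real.sqrt (v j) :=
        Real.sqrt_lt_sqrt (hv0 i).le (hvlt i j hij hj)
      have h5 : φ i < φ j := Real.strictMonoOn_arcsin
        ⟨by linarith [Real.sqrt_nonneg (v i)], hsq1 i⟩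
        ⟨by linarith [Real.sqrt_nonneg (v j)], hsq1 j⟩ h4
      linarith
  have hsx : ∀ j, 0 < Real.sin (Real.pi * x j) := fun j =>
    Real.sin_pos_of_pos_of_lt_pi (mul_pos hpi (hx0 j)) (by linarith [hxle' j, hφle j])
  have key := abs_eval_zero_le_eval_T hp (A := A) hy1
    (u := fun j => Real.sin (Real.pi * x j) ^ 2) (fun j _ => pow_pos (hsx j) 2)
    (fun i j hij hj => ?_) (fun j _ => hA _ (hxF j))
  · have hA0 : 0 ≤ A := (abs_nonneg _).trans (hA _ (hxF 0))
    refine key.trans (mul_le_mul_of_nonneg_left ((eval_T_le_exp hr0.le hr2).trans ?_) hA0)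
    apply Real.exp_le_exp.mpr
    have : (0 : ℝ) ≤ n := Nat.cast_nonneg n
    nlinarith
  · have h1 := sin_div_sin_le_sin_div_sin (mul_pos hpi (hx0 i)) (hxle' i) (hφlt i j hij hj)
      (hxle' j) (hxd i j hij hj) (hφle j)
    have h2 : (y - node n j) / (y - node n i) = (Real.sin (φ j) / Real.sin (φ i)) ^ 2 := by
      rw [div_pow, hsin, hsin, Real.sq_sqrt (hv0 j).le, Real.sq_sqrt (hv0 i).le]
      simp only [hv]
      rw [mul_div_mul_left _ _ (by positivity)]
    rw [h2, ← div_pow]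
    refine pow_le_pow_left₀ (div_nonneg ?_ ?_) h1 2
    · rw [hsin]; exact Real.sqrt_nonneg _
    · rw [hsin]; exact Real.sqrt_nonneg _

/-! ### Remez inequality on the circle. -/

theorem circlePoint_coe (θ : ℝ) : circlePoint (θ : UnitAddCircle) =
    Complex.exp ((2 * Real.pi * θ : ℝ) * Complex.I) := by
  rw [circlePoint, AddCircle.toCircle_apply_mk, Circle.coe_exp]
  norm_num

theorem norm_circlePoint (t : UnitAddCircle) : ‖circlePoint t‖ = 1 := Circle.norm_coe _

theorem circlePoint_add (s t : UnitAddCircle) :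
    circlePoint (s + t) = circlePoint s * circlePoint t := by
  simp [circlePoint, AddCircle.toCircle_add]

theorem continuous_circlePoint : Continuous circlePoint :=
  continuous_subtype_val.comp AddCircle.continuous_toCircle

theorem circlePoint_injective : Function.Injective circlePoint :=
  Subtype.val_injective.comp (AddCircle.injective_toCircle one_ne_zero)

open Polynomial Polynomial.Chebyshev ComplexConjugate in
/-- The even part of `|Q|²` about a point of the circle is a polynomial in `sin²` of half the
angle. -/
theorem exists_eval_sin_sq_eq_norm_sq_add_norm_sq {n : ℕ} {Q : ℂ[X]} (hQ : Q.natDegree ≤ n)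
    (w : ℂ) : ∃ p : ℝ[X], p.natDegree ≤ n ∧ ∀ ψ : ℝ, p.eval (Real.sin ψ ^ 2) =
      (‖Q.eval (w * Complex.exp ((2 * ψ : ℝ) * Complex.I))‖ ^ 2 +
        ‖Q.eval (w * Complex.exp ((2 * (-ψ) : ℝ) * Complex.I))‖ ^ 2) / 2 := by
  set b : ℕ → ℂ := fun j => Q.coeff j * w ^ j with hb
  -- Averaging the cross terms b_j conj(b_k) e^(i(j-k)η) over η = ±2ψ leaves cos(2(j-k)ψ), which is
  -- T_(j-k)(1 - 2 sin²ψ).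
  refine ⟨∑ j ∈ Finset.range (n + 1), ∑ k ∈ Finset.range (n + 1),
    C ((b j * conj (b k)).re) * (T ℝ ((j : ℤ) - k)).comp (1 - 2 * X), ?_, fun ψ => ?_⟩
  · refine natDegree_sum_le_of_forall_le _ _ fun j hj =>
      natDegree_sum_le_of_forall_le _ _ fun k hk => ?_
    refine (natDegree_C_mul_le _ _).trans (natDegree_comp_le.trans ?_)
    have h1 : (1 - 2 * X : ℝ[X]).natDegree ≤ 1 := by compute_degree
    have h2 : (T ℝ ((j : ℤ) - k)).natDegree ≤ n := by
      rw [natDegree_T]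
      simp only [Finset.mem_range] at hj hk
      omega
    calc _ ≤ n * 1 := Nat.mul_le_mul h2 h1
      _ = n := mul_one n
  · have hcos : (1 - 2 * X : ℝ[X]).eval (Real.sin ψ ^ 2) = Real.cos (2 * ψ) := by
      simp only [eval_sub, eval_one, eval_mul, eval_ofNat, eval_X]
      rw [Real.cos_two_mul, Real.cos_sq']
      ring
    have hn : ∀ η : ℝ, ‖Q.eval (w * Complex.exp ((η : ℝ) * Complex.I))‖ ^ 2 =
        ∑ j ∈ Finset.range (n + 1), ∑ k ∈ Finset.range (n + 1),
          (b j * conj (b k) * Complex.exp (((((j : ℤ) - k : ℤ) : ℝ) * η : ℝ) * Complex.I)).re := by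
      intro η
      have h1 : ∀ S : ℂ, ‖S‖ ^ 2 = (S * conj S).re := fun S => by
        rw [Complex.mul_conj, Complex.ofReal_re, Complex.normSq_eq_norm_sq]
      rw [h1, eval_eq_sum_range' (Nat.lt_succ_of_le hQ), map_sum, Finset.sum_mul_sum, Complex.re_sum]
      refine Finset.sum_congr rfl fun j _ => ?_
      rw [Complex.re_sum]
      refine Finset.sum_congr rfl fun k _ => ?_
      congr 1
      have h2 : Complex.exp (((((j : ℤ) - k : ℤ) : ℝ) * η : ℝ) * Complex.I) =
          Complex.exp (η * Complex.I) ^ j * conj (Complex.exp (η * Complex.I)) ^ k := by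
        rw [← Complex.exp_conj, ← Complex.exp_nat_mul, ← Complex.exp_nat_mul, ← Complex.exp_add]
        congr 1
        simp only [map_mul, Complex.conj_I, Complex.conj_ofReal]
        push_cast
        ring
      rw [h2]
      simp only [hb, map_mul, map_pow]
      ring
    rw [hn, hn, ← Finset.sum_add_distrib, Finset.sum_div, eval_finsetSum]
    refine Finset.sum_congr rfl fun j _ => ?_
    rw [← Finset.sum_add_distrib, Finset.sum_div, eval_finsetSum]
    refine Finset.sum_congr rfl fun k _ => ?_
    rw [eval_mul, eval_C, eval_comp, hcos, T_real_cos]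
    generalize b j * conj (b k) = β
    rw [Complex.mul_re, Complex.mul_re, Complex.exp_ofReal_mul_I_re,
      Complex.exp_ofReal_mul_I_re, Complex.exp_ofReal_mul_I_im, Complex.exp_ofReal_mul_I_im]
    have h3 : ((((j : ℤ) - k : ℤ) : ℝ) * (2 * -ψ)) = -((((j : ℤ) - k : ℤ) : ℝ) * (2 * ψ)) := by ring
    rw [h3, Real.cos_neg, Real.sin_neg]
    ring

theorem volume_real_Icc_inter_preimage_le {s : ℝ → UnitAddCircle} {G : Set UnitAddCircle}
    (hG : MeasurableSet G)
    (hs : MeasurePreserving s (volume.restrict (Set.Ioc 0 1)) volume) :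
    volume.real (Set.Icc (0 : ℝ) (1 / 2) ∩ s ⁻¹' G) ≤ volume.real G := by
  have h1 : volume (s ⁻¹' G ∩ Set.Ioc 0 1) = volume G := by
    rw [← hs.measure_preimage hG.nullMeasurableSet, Measure.restrict_apply (hs.measurable hG)]
  have h2 : Set.Icc (0 : ℝ) (1 / 2) ∩ s ⁻¹' G ⊆ (s ⁻¹' G ∩ Set.Ioc 0 1) ∪ {0} := fun x hx => by
    rcases hx.1.1.eq_or_lt with h | h
    · exact Or.inr h.symm
    · exact Or.inl ⟨hx.2, h, by linarith [hx.1.2]⟩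
  have h3 : volume (Set.Icc (0 : ℝ) (1 / 2) ∩ s ⁻¹' G) ≤ volume G := by
    refine (measure_mono h2).trans ((measure_union_le _ _).trans ?_)
    simp [h1]
  exact ENNReal.toReal_mono (measure_ne_top _ _) h3

open Polynomial in
/-- A Remez inequality on the circle: a polynomial of degree at most `n` that is bounded outside a
set of measure `ε` is bounded everywhere, with a loss that is exponential in `ε n`. -/
theorem norm_sq_eval_circlePoint_le {n : ℕ} {Q : ℂ[X]} (hQ : Q.natDegree ≤ n)
    {F : Set UnitAddCircle} (hF : IsClosed F) {ε A : ℝ} (hε0 : 0 < ε) (hε : ε ≤ 1 / 32)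
    (hFε : volume.real Fᶜ ≤ ε) (hA : ∀ t ∈ F, ‖Q.eval (circlePoint t)‖ ^ 2 ≤ A)
    (t₀ : UnitAddCircle) :
    ‖Q.eval (circlePoint t₀)‖ ^ 2 ≤ A * Real.exp (12 * Real.pi * ε * n) := by
  obtain ⟨p, hp, hpe⟩ := exists_eval_sin_sq_eq_norm_sq_add_norm_sq hQ (circlePoint t₀)
  have hmk : MeasurePreserving ((↑) : ℝ → UnitAddCircle) (volume.restrict (Set.Ioc 0 1)) volume := by
    simpa using UnitAddCircle.measurePreserving_mk 0
  set s₁ : ℝ → UnitAddCircle := fun x => t₀ + (x : UnitAddCircle) with hs₁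
  set s₂ : ℝ → UnitAddCircle := fun x => t₀ - (x : UnitAddCircle) with hs₂
  have hm₁ : MeasurePreserving s₁ (volume.restrict (Set.Ioc 0 1)) volume :=
    (measurePreserving_add_left volume t₀).comp hmk
  have hm₂ : MeasurePreserving s₂ (volume.restrict (Set.Ioc 0 1)) volume :=
    (Measure.measurePreserving_sub_left volume t₀).comp hmk
  have hmkc : Continuous ((↑) : ℝ → UnitAddCircle) := AddCircle.continuous_mk' 1
  have hc₁ : Continuous s₁ := continuous_const.add hmkc
  have hc₂ : Continuous s₂ := continuous_const.sub hmkc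
  have hval : ∀ x : ℝ, p.eval (Real.sin (Real.pi * x) ^ 2) =
      (‖Q.eval (circlePoint (s₁ x))‖ ^ 2 + ‖Q.eval (circlePoint (s₂ x))‖ ^ 2) / 2 := fun x => by
    rw [hpe, hs₁, hs₂]
    simp only [sub_eq_add_neg, circlePoint_add, ← AddCircle.coe_neg, circlePoint_coe]
    congr 6 <;> ring_nf
  have hcl : IsClosed (s₁ ⁻¹' F ∩ s₂ ⁻¹' F) := (hF.preimage hc₁).inter (hF.preimage hc₂)
  -- Folding the circle about t₀ requires both t₀ + x and t₀ - x to lie in F, which doubles the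
  -- exceptional measure.
  have hvol : volume.real (Set.Icc (0 : ℝ) (1 / 2) \ (s₁ ⁻¹' F ∩ s₂ ⁻¹' F)) ≤ 2 * ε := by
    have h1 : Set.Icc (0 : ℝ) (1 / 2) \ (s₁ ⁻¹' F ∩ s₂ ⁻¹' F) =
        (Set.Icc (0 : ℝ) (1 / 2) ∩ s₁ ⁻¹' Fᶜ) ∪ (Set.Icc (0 : ℝ) (1 / 2) ∩ s₂ ⁻¹' Fᶜ) := by
      ext x
      simp only [Set.mem_sdiff, Set.mem_inter_iff, Set.mem_preimage, Set.mem_union,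
        Set.mem_compl_iff]
      tauto
    rw [h1]
    have h2 := volume_real_Icc_inter_preimage_le hF.isOpen_compl.measurableSet hm₁
    have h3 := volume_real_Icc_inter_preimage_le hF.isOpen_compl.measurableSet hm₂
    have h4 := measureReal_union_le (μ := volume) (Set.Icc (0 : ℝ) (1 / 2) ∩ s₁ ⁻¹' Fᶜ)
      (Set.Icc (0 : ℝ) (1 / 2) ∩ s₂ ⁻¹' Fᶜ)
    linarith
  have key := abs_eval_zero_le_of_abs_eval_sin_sq_le hp hcl (ε := 2 * ε) (A := A)
    (by linarith) (by linarith) hvol (fun x hx => by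
      rw [hval, abs_of_nonneg (by positivity)]
      linarith [hA _ hx.1, hA _ hx.2])
  have h0 : p.eval 0 = ‖Q.eval (circlePoint t₀)‖ ^ 2 := by
    have := hpe 0
    simpa using this
  rw [h0, abs_of_nonneg (by positivity)] at key
  convert key using 3
  ring

/-! ### Geometry of K: density near 1, neighbourhoods, integrals of `d_K ^ (-p)`. -/

theorem UnitAddCircle.norm_coe_le_abs (x : ℝ) : ‖(x : UnitAddCircle)‖ ≤ |x| :=
  QuotientAddGroup.norm_mk_le_norm

theorem mem_powerSeqSet {ν : ℝ} {t : UnitAddCircle} : t ∈ powerSeqSet ν ↔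
    (∃ k : ℕ, 1 ≤ k ∧ t = (((k : ℝ) ^ (-ν) : ℝ) : UnitAddCircle)) ∨ t = 0 := by
  have h0 : circlePoint 0 = 1 := by simp [circlePoint]
  have h1 : ∀ x : ℝ, Complex.exp (2 * Real.pi * Complex.I * (x : ℂ)) =
      circlePoint (x : UnitAddCircle) := fun x => by
    rw [circlePoint_coe]
    congr 1
    push_cast
    ring
  simp only [powerSeqSet, Set.mem_ofPred_eq, h1, circlePoint_injective.eq_iff]
  rw [← h0, circlePoint_injective.eq_iff]

theorem zero_mem_powerSeqSet (ν : ℝ) : (0 : UnitAddCircle) ∈ powerSeqSet ν :=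
  mem_powerSeqSet.mpr (Or.inr rfl)

theorem infDist_powerSeqSet_le_half (ν : ℝ) (t : UnitAddCircle) :
    Metric.infDist t (powerSeqSet ν) ≤ 1 / 2 := by
  refine (Metric.infDist_le_dist_of_mem (zero_mem_powerSeqSet ν)).trans ?_
  rw [dist_zero_right]
  simpa using AddCircle.norm_le_half_period 1 one_ne_zero (x := t)

/-- On `[0, ε]` the points `k ^ (-ν)` are spaced by at most `ν ε ^ (1 + 1 / ν)`. -/
theorem infDist_powerSeqSet_le {ν : ℝ} (hν : 0 < ν) {θ ε : ℝ} (hθ : 0 ≤ θ) (hθε : θ ≤ ε) :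
    Metric.infDist (θ : UnitAddCircle) (powerSeqSet ν) ≤ ν * ε ^ (1 + 1 / ν) := by
  have hε0 : 0 ≤ ε := hθ.trans hθε
  rcases hθ.eq_or_lt with rfl | hθ0
  · rw [AddCircle.coe_zero, Metric.infDist_zero_of_mem (zero_mem_powerSeqSet ν)]
    positivity
  -- θ = a^(-ν), and k = ⌈a⌉ gives a point of K not beyond θ. The Bernoulli bound (1 + 1/a)^(-ν) ≥ 1
  -- - ν/a controls its distance from θ.
  set a := θ ^ (-(1 / ν)) with ha
  have ha0 : 0 < a := Real.rpow_pos_of_pos hθ0 _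
  have haν : a ^ (-ν) = θ := by
    rw [ha, ← Real.rpow_mul hθ0.le]
    have : -(1 / ν) * -ν = 1 := by field_simp
    rw [this, Real.rpow_one]
  have ha1 : a⁻¹ = θ ^ (1 / ν) := by rw [ha, Real.rpow_neg hθ0.le, inv_inv]
  set k := ⌈a⌉₊ with hk
  have hk1 : 1 ≤ k := Nat.one_le_iff_ne_zero.mpr (Nat.ceil_pos.mpr ha0).ne'
  have hka : a ≤ k := Nat.le_ceil a
  have hka1 : (k : ℝ) < a + 1 := Nat.ceil_lt_add_one ha0.le
  have hk0 : (0 : ℝ) < k := by exact_mod_cast hk1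
  have hup : (k : ℝ) ^ (-ν) ≤ θ := by
    rw [← haν]
    exact Real.rpow_le_rpow_of_nonpos ha0 hka (by linarith)
  have hlo : θ * (1 - ν * θ ^ (1 / ν)) ≤ (k : ℝ) ^ (-ν) := by
    have h1 : (a + 1) ^ (-ν) ≤ (k : ℝ) ^ (-ν) :=
      Real.rpow_le_rpow_of_nonpos hk0 hka1.le (by linarith)
    have h2 : a + 1 = a * (1 + a⁻¹) := by field_simp
    have h3 : 1 - ν * a⁻¹ ≤ (1 + a⁻¹) ^ (-ν) := by
      have hinv : 0 < a⁻¹ := inv_pos.mpr ha0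
      have h4 : Real.log (1 + a⁻¹) ≤ a⁻¹ := by
        have := Real.log_le_sub_one_of_pos (by linarith : 0 < 1 + a⁻¹)
        linarith
      rw [Real.rpow_def_of_pos (by linarith)]
      have h5 := Real.add_one_le_exp (Real.log (1 + a⁻¹) * -ν)
      nlinarith
    rw [h2, Real.mul_rpow ha0.le (by positivity), haν] at h1
    rw [← ha1]
    exact (mul_le_mul_of_nonneg_left h3 hθ).trans h1
  have hmem : (((k : ℝ) ^ (-ν) : ℝ) : UnitAddCircle) ∈ powerSeqSet ν :=
    mem_powerSeqSet.mpr (Or.inl ⟨k, hk1, rfl⟩)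
  refine (Metric.infDist_le_dist_of_mem hmem).trans ?_
  rw [dist_eq_norm, ← AddCircle.coe_sub]
  refine (UnitAddCircle.norm_coe_le_abs _).trans ?_
  rw [abs_of_nonneg (by linarith)]
  have h6 : θ ^ (1 + 1 / ν) = θ * θ ^ (1 / ν) := by rw [Real.rpow_add hθ0, Real.rpow_one]
  have h7 : θ ^ (1 + 1 / ν) ≤ ε ^ (1 + 1 / ν) := by gcongr
  have h8 : ν * θ ^ (1 + 1 / ν) ≤ ν * ε ^ (1 + 1 / ν) := by gcongr
  rw [h6] at h8
  linarith

theorem UnitAddCircle.volume_real_closedBall_le (x : UnitAddCircle) {r : ℝ} (hr : 0 ≤ r) :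
    volume.real (Metric.closedBall x r) ≤ 2 * r := by
  rw [measureReal_def, AddCircle.volume_closedBall, ENNReal.toReal_ofReal (by positivity)]
  exact min_le_right _ _

/-- Cut the sequence at k₀ near δ^(-1/(ν+1)), where its spacing is comparable to δ. The tail lies in
one ball of radius k₀^(-ν) + δ, the other points get a ball each, and both contributions have order
δ^(ν/(ν+1)). -/
theorem volume_real_infDist_powerSeqSet_lt_le {ν : ℝ} (hν : 0 < ν) {δ : ℝ} (hδ : 0 < δ) :
    volume.real {t | Metric.infDist t (powerSeqSet ν) < δ} ≤ 8 * δ ^ (ν / (ν + 1)) := by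
  have hth : 0 ≤ ν / (ν + 1) := by positivity
  rcases le_total 1 δ with h1 | h1
  · have h2 : 1 ≤ δ ^ (ν / (ν + 1)) := Real.one_le_rpow h1 hth
    have h3 : volume.real {t | Metric.infDist t (powerSeqSet ν) < δ} ≤
        volume.real (Set.univ : Set UnitAddCircle) := measureReal_mono (Set.subset_univ _)
    have h4 : volume.real (Set.univ : Set UnitAddCircle) = 1 := by
      rw [measureReal_def, AddCircle.measure_univ]; simp
    linarith
  set a := δ ^ (-(1 / (ν + 1))) with ha
  have ha0 : 0 < a := Real.rpow_pos_of_pos hδ _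
  set k₀ := ⌈a⌉₊ with hk₀
  have hka : a ≤ k₀ := Nat.le_ceil a
  have hka1 : (k₀ : ℝ) < a + 1 := Nat.ceil_lt_add_one ha0.le
  -- The index k = 0 in the range adds a superfluous ball, harmless for a cover.
  have hsub : {t | Metric.infDist t (powerSeqSet ν) < δ} ⊆
      Metric.closedBall 0 ((k₀ : ℝ) ^ (-ν) + δ) ∪
        ⋃ k ∈ Finset.range k₀, Metric.closedBall (((k : ℝ) ^ (-ν) : ℝ) : UnitAddCircle) δ := by
    intro t ht
    obtain ⟨s, hs, hts⟩ := (Metric.infDist_lt_iff ⟨0, zero_mem_powerSeqSet ν⟩).mp ht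
    have hk₀0 : 0 ≤ (k₀ : ℝ) ^ (-ν) := by positivity
    rcases mem_powerSeqSet.mp hs with ⟨k, hk, rfl⟩ | rfl
    · rcases lt_or_ge k k₀ with h | h
      · right
        simp only [Set.mem_iUnion, Finset.mem_range]
        exact ⟨k, h, hts.le⟩
      · left
        rw [Metric.mem_closedBall]
        have h2 := dist_triangle t (((k : ℝ) ^ (-ν) : ℝ) : UnitAddCircle) 0
        have h3 : dist (((k : ℝ) ^ (-ν) : ℝ) : UnitAddCircle) 0 ≤ (k : ℝ) ^ (-ν) := by
          rw [dist_zero_right]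
          refine (UnitAddCircle.norm_coe_le_abs _).trans ?_
          rw [abs_of_nonneg (by positivity)]
        have h4 : (k : ℝ) ^ (-ν) ≤ (k₀ : ℝ) ^ (-ν) :=
          Real.rpow_le_rpow_of_nonpos (ha0.trans_le hka) (by exact_mod_cast h) (by linarith)
        linarith
    · left
      rw [Metric.mem_closedBall]
      linarith
  have h2 : (k₀ : ℝ) ^ (-ν) ≤ δ ^ (ν / (ν + 1)) := by
    have : δ ^ (ν / (ν + 1)) = a ^ (-ν) := by
      rw [ha, ← Real.rpow_mul hδ.le]
      congr 1
      field_simp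
    rw [this]
    exact Real.rpow_le_rpow_of_nonpos ha0 hka (by linarith)
  have h3 : δ * a = δ ^ (ν / (ν + 1)) := by
    have : ν / (ν + 1) = 1 + -(1 / (ν + 1)) := by field_simp; ring
    rw [this, Real.rpow_add hδ, Real.rpow_one]
  have h4 : δ ≤ δ ^ (ν / (ν + 1)) := by
    have : ν / (ν + 1) ≤ 1 := by rw [div_le_one (by linarith)]; linarith
    calc δ = δ ^ (1 : ℝ) := (Real.rpow_one δ).symm
      _ ≤ _ := Real.rpow_le_rpow_of_exponent_ge hδ h1 this
  have h5 : volume.real {t | Metric.infDist t (powerSeqSet ν) < δ} ≤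
      2 * ((k₀ : ℝ) ^ (-ν) + δ) + k₀ * (2 * δ) := by
    refine (measureReal_mono hsub (measure_ne_top _ _)).trans
      ((measureReal_union_le _ _).trans (add_le_add
        (UnitAddCircle.volume_real_closedBall_le _ (by positivity)) ?_))
    refine (measureReal_biUnion_finset_le _ _).trans ?_
    refine (Finset.sum_le_sum fun k _ =>
      UnitAddCircle.volume_real_closedBall_le _ hδ.le).trans ?_
    simp
  nlinarith

/-- If the `δ`-neighbourhoods of `K` have measure `O(δ ^ θ)` with `θ < p`, then the integral of
`d_K ^ (-p)` at distance at least `δ` is `O(δ ^ (θ - p))`. -/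
theorem setIntegral_infDist_rpow_neg_le {K : Set UnitAddCircle} {θ p B : ℝ} (hp : 0 < p)
    (hθp : θ < p) (hB : 0 ≤ B) (hhalf : ∀ t, Metric.infDist t K ≤ 1 / 2)
    (hK : ∀ δ > 0, volume.real {t | Metric.infDist t K < δ} ≤ B * δ ^ θ) {δ : ℝ} (hδ : 0 < δ) :
    IntegrableOn (fun t => Metric.infDist t K ^ (-p)) {t | δ ≤ Metric.infDist t K} ∧
      ∫ t in {t | δ ≤ Metric.infDist t K}, Metric.infDist t K ^ (-p) ≤
        B * 2 ^ θ / (1 - 2 ^ (θ - p)) * δ ^ (θ - p) := by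
  have hcd : Continuous fun t => Metric.infDist t K := Metric.continuous_infDist_pt K
  have hmeas : Measurable fun t => Metric.infDist t K ^ (-p) := hcd.measurable.pow_const _
  have hms : ∀ δ : ℝ, MeasurableSet {t | δ ≤ Metric.infDist t K} := fun δ =>
    (isClosed_le continuous_const hcd).measurableSet
  have hint : ∀ δ > 0, IntegrableOn (fun t => Metric.infDist t K ^ (-p))
      {t | δ ≤ Metric.infDist t K} := fun δ hδ => by
    refine Measure.integrableOn_of_bounded (M := δ ^ (-p)) (measure_ne_top _ _)
      hmeas.aestronglyMeasurable ?_
    filter_upwards [ae_restrict_mem (hms δ)] with t ht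
    rw [Real.norm_of_nonneg (Real.rpow_nonneg Metric.infDist_nonneg _)]
    exact Real.rpow_le_rpow_of_nonpos hδ ht (by linarith)
  refine ⟨hint δ hδ, ?_⟩
  have hq : (2 : ℝ) ^ (θ - p) < 1 := Real.rpow_lt_one_of_one_lt_of_neg (by norm_num) (by linarith)
  set A := B * 2 ^ θ / (1 - 2 ^ (θ - p)) with hA
  have hAeq : A * 2 ^ (θ - p) + B * 2 ^ θ = A := by
    rw [hA]
    have : 1 - (2 : ℝ) ^ (θ - p) ≠ 0 := by linarith
    field_simp
    ring
  have hA0 : 0 ≤ A := div_nonneg (by positivity) (by linarith)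
  -- Dyadic summation: J doublings take δ beyond 1/2, where the set is empty. The constant A is the
  -- fixed point of A ↦ A·2^(θ-p) + B·2^θ, so it survives each step.
  have main : ∀ J : ℕ, ∀ δ > 0, 1 / 2 < 2 ^ J * δ →
      ∫ t in {t | δ ≤ Metric.infDist t K}, Metric.infDist t K ^ (-p) ≤ A * δ ^ (θ - p) := by
    intro J
    induction J with
    | zero =>
      intro δ hδ h
      have : {t | δ ≤ Metric.infDist t K} = ∅ := by
        ext t
        simp only [Set.mem_ofPred_eq, Set.mem_empty_iff_false, iff_false, not_le]
        linarith [hhalf t]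
      rw [this, Measure.restrict_empty, integral_zero_measure]
      positivity
    | succ J ih =>
      intro δ hδ h
      have h1 := ih (2 * δ) (by positivity) (by rw [pow_succ] at h; linarith)
      have hsplit : {t | δ ≤ Metric.infDist t K} =
          {t | 2 * δ ≤ Metric.infDist t K} ∪
            ({t | Metric.infDist t K < 2 * δ} ∩ {t | δ ≤ Metric.infDist t K}) := by
        ext t
        simp only [Set.mem_ofPred_eq, Set.mem_union, Set.mem_inter_iff]
        rcases lt_or_ge (Metric.infDist t K) (2 * δ) with h | h
        · simp [h]
        · simp only [h, true_or, iff_true]; linarith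
      have hm2 : MeasurableSet ({t | Metric.infDist t K < 2 * δ} ∩ {t | δ ≤ Metric.infDist t K}) :=
        (isOpen_lt hcd continuous_const).measurableSet.inter (hms δ)
      have hdisj : Disjoint {t | 2 * δ ≤ Metric.infDist t K}
          ({t | Metric.infDist t K < 2 * δ} ∩ {t | δ ≤ Metric.infDist t K}) := by
        rw [Set.disjoint_left]
        intro t ht ht'
        have h1 : Metric.infDist t K < 2 * δ := ht'.1
        have h2 : 2 * δ ≤ Metric.infDist t K := ht
        linarith
      have hi2 := (hint δ hδ).mono_set (Set.inter_subset_right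
        (s := {t | Metric.infDist t K < 2 * δ}))
      rw [hsplit, setIntegral_union hdisj hm2 (hint (2 * δ) (by positivity)) hi2]
      have h2 : ∫ t in {t | Metric.infDist t K < 2 * δ} ∩ {t | δ ≤ Metric.infDist t K},
          Metric.infDist t K ^ (-p) ≤ B * (2 * δ) ^ θ * δ ^ (-p) := by
        calc _ ≤ ∫ t in {t | Metric.infDist t K < 2 * δ} ∩ {t | δ ≤ Metric.infDist t K},
              δ ^ (-p) := by
              refine setIntegral_mono_on hi2 integrableOn_const hm2 fun t ht => ?_
              exact Real.rpow_le_rpow_of_nonpos hδ ht.2 (by linarith)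
          _ = volume.real ({t | Metric.infDist t K < 2 * δ} ∩ {t | δ ≤ Metric.infDist t K}) *
              δ ^ (-p) := by rw [setIntegral_const, smul_eq_mul]
          _ ≤ _ := by
              gcongr
              exact (measureReal_mono Set.inter_subset_left).trans (hK _ (by positivity))
      have h3 : (2 * δ) ^ (θ - p) = 2 ^ (θ - p) * δ ^ (θ - p) :=
        Real.mul_rpow (by norm_num) hδ.le
      have h4 : B * (2 * δ) ^ θ * δ ^ (-p) = B * 2 ^ θ * δ ^ (θ - p) := by
        rw [Real.mul_rpow (by norm_num) hδ.le, sub_eq_add_neg θ p, Real.rpow_add hδ]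
        ring
      rw [h3] at h1
      rw [h4] at h2
      calc _ ≤ A * (2 ^ (θ - p) * δ ^ (θ - p)) + B * 2 ^ θ * δ ^ (θ - p) := add_le_add h1 h2
        _ = (A * 2 ^ (θ - p) + B * 2 ^ θ) * δ ^ (θ - p) := by ring
        _ = _ := by rw [hAeq]
  obtain ⟨J, hJ⟩ := pow_unbounded_of_one_lt (1 / 2 / δ) (by norm_num : (1 : ℝ) < 2)
  exact main J δ hδ (by rwa [div_lt_iff₀ hδ] at hJ)

/-! ### Jensen's inequality and the Szegő-type lower bound. -/

theorem UnitAddCircle.measurePreserving_coe :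
    MeasurePreserving ((↑) : ℝ → UnitAddCircle) (volume.restrict (Set.Ioc 0 1)) volume := by
  simpa using UnitAddCircle.measurePreserving_mk 0

open Polynomial in
theorem integrable_log_norm_eval_circlePoint (P : ℂ[X]) :
    Integrable (fun t : UnitAddCircle => Real.log ‖P.eval (circlePoint t)‖) := by
  have hm : Measurable (fun t : UnitAddCircle => Real.log ‖P.eval (circlePoint t)‖) :=
    (P.continuous.comp continuous_circlePoint).norm.measurable.log
  rw [← UnitAddCircle.measurePreserving_coe.integrable_comp hm.aestronglyMeasurable]
  have h1 := (intervalIntegrable_mahlerMeasure (p := P)).comp_mul_left (c := 2 * Real.pi)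
  rw [zero_div, div_self Real.two_pi_pos.ne'] at h1
  have h2 := (intervalIntegrable_iff_integrableOn_Ioc_of_le zero_le_one).mp h1
  refine h2.congr (Filter.Eventually.of_forall fun x => ?_)
  simp only [Function.comp, circlePoint_coe, circleMap, zero_add, Complex.ofReal_one, one_mul]

-- Jensen's formula: a monic polynomial has Mahler measure at least 1.
open Polynomial in
theorem integral_log_norm_eval_circlePoint_nonneg {P : ℂ[X]} (hP : P.Monic) :
    0 ≤ ∫ t : UnitAddCircle, Real.log ‖P.eval (circlePoint t)‖ := by
  have h1 : 0 ≤ P.logMahlerMeasure := by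
    rw [logMahlerMeasure_eq_log_MahlerMeasure]
    exact Real.log_nonneg (one_le_mahlerMeasure_of_one_le_norm_leadingCoeff (by simp [hP]))
  rw [logMahlerMeasure_def, Real.circleAverage_def] at h1
  rw [← UnitAddCircle.intervalIntegral_preimage 0]
  have h2 := intervalIntegral.integral_comp_mul_left (a := 0) (b := 1)
    (fun x => Real.log ‖P.eval (circleMap 0 1 x)‖) Real.two_pi_pos.ne'
  rw [mul_zero, mul_one] at h2
  rw [← h2] at h1
  refine h1.trans_eq ?_
  rw [zero_add]
  refine intervalIntegral.integral_congr fun x _ => ?_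
  simp only [circlePoint_coe, circleMap, zero_add, Complex.ofReal_one, one_mul]

open Polynomial in
theorem ae_eval_circlePoint_ne_zero {P : ℂ[X]} (hP : P ≠ 0) :
    ∀ᵐ t : UnitAddCircle, P.eval (circlePoint t) ≠ 0 := by
  have hfin : {t : UnitAddCircle | P.eval (circlePoint t) = 0}.Finite := by
    refine Set.Finite.preimage circlePoint_injective.injOn (s := {z | P.eval z = 0}) ?_
    refine (P.roots.toFinset.finite_toSet).subset fun z hz => ?_
    simpa [hP] using hz
  have hna : NullSingletonClass (volume : Measure UnitAddCircle) := by
    refine ⟨fun x => ?_⟩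
    have := AddCircle.volume_closedBall (T := 1) (x := x) 0
    simpa using this
  have := hfin.measure_zero volume
  simpa [ae_iff] using this

open Polynomial in
/-- A Szegő-type lower bound for `∫ |P|² W`: off an open set `E` of small measure the weight is
`exp (-h)` with `h ≤ M`, and on `E` nothing is assumed but `W ≥ 0`. -/
theorem exp_neg_le_of_integral_norm_sq_mul_le {n : ℕ} {P : ℂ[X]} (hP : P.Monic)
    (hn : P.natDegree ≤ n) {W h : UnitAddCircle → ℝ} (hWm : Measurable W) (hW0 : ∀ t, 0 ≤ W t)
    (hW1 : ∀ t, W t ≤ 1) {E : Set UnitAddCircle} (hE : IsOpen E) {ε M J Y : ℝ} (hε0 : 0 < ε)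
    (hε : ε ≤ 1 / 64) (hEε : volume.real E ≤ ε) (hM : 0 ≤ M) (hhM : ∀ t ∈ Eᶜ, h t ≤ M)
    (hWh : ∀ t ∈ Eᶜ, W t = Real.exp (-h t)) (hhi : IntegrableOn h Eᶜ)
    (hJ : ∫ t in Eᶜ, h t ≤ J) (hY0 : 0 < Y) (hY1 : Y ≤ 1)
    (hX : ∫ t, ‖P.eval (circlePoint t)‖ ^ 2 * W t ≤ Y) :
    Real.exp (-(2 * (J + 1 + ε * (M + Real.log ε⁻¹ + 24 * Real.pi * ε * n)))) ≤ Y := by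
  set f : UnitAddCircle → ℝ := fun t => ‖P.eval (circlePoint t)‖ ^ 2 with hf
  have hfc : Continuous f := (P.continuous.comp continuous_circlePoint).norm.pow 2
  have hf0 : ∀ t, 0 ≤ f t := fun t => by positivity
  have hEm := hE.measurableSet
  have hfi : Integrable (fun t => f t * W t) := by
    obtain ⟨C, hC⟩ := (isCompact_range hfc).isBounded.exists_norm_le
    refine Integrable.of_bound (hfc.measurable.mul hWm).aestronglyMeasurable C
      (Filter.Eventually.of_forall fun t => ?_)
    have h1 := hC (f t) ⟨t, rfl⟩
    rw [norm_mul, Real.norm_of_nonneg (hW0 t)]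
    nlinarith [hW1 t, hW0 t, norm_nonneg (f t)]
  -- By Markov's inequality |P|²W < Y/ε outside measure ε. As W ≥ exp(-M) off E, |P|² ≤ A outside
  -- measure 2ε, which is the input for Remez.
  set A := Y * Real.exp M / ε with hA
  have hA0 : 0 < A := by positivity
  have hbad : volume.real {t | Y / ε ≤ f t * W t} ≤ ε := by
    have h1 := mul_meas_ge_le_integral_of_nonneg (μ := volume)
      (Filter.Eventually.of_forall fun t => mul_nonneg (hf0 t) (hW0 t)) hfi (Y / ε)
    have h2 : Y / ε * volume.real {t | Y / ε ≤ f t * W t} ≤ Y := h1.trans hX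
    rw [div_mul_eq_mul_div, div_le_iff₀ hε0] at h2
    exact le_of_mul_le_mul_left h2 hY0
  have hFm : volume.real (Eᶜ ∩ {t | f t ≤ A})ᶜ ≤ 2 * ε := by
    have h1 : (Eᶜ ∩ {t | f t ≤ A})ᶜ ⊆ E ∪ {t | Y / ε ≤ f t * W t} := fun t ht => by
      by_cases htE : t ∈ E
      · exact Or.inl htE
      · right
        have h2 : A < f t := by
          by_contra hc
          exact ht ⟨htE, not_lt.mp hc⟩
        change Y / ε ≤ f t * W t
        rw [hWh t htE]
        have h3 : Real.exp (-M) ≤ Real.exp (-h t) := Real.exp_le_exp.mpr (by linarith [hhM t htE])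
        calc Y / ε = A * Real.exp (-M) := by rw [hA, Real.exp_neg]; field_simp
          _ ≤ f t * Real.exp (-h t) := mul_le_mul h2.le h3 (Real.exp_pos _).le (hf0 t)
    have h2 := (measureReal_mono (μ := volume) h1).trans (measureReal_union_le _ _)
    linarith
  have hremez : ∀ t, f t ≤ A * Real.exp (12 * Real.pi * (2 * ε) * n) :=
    norm_sq_eval_circlePoint_le hn (hE.isClosed_compl.inter (isClosed_le hfc continuous_const))
      (by linarith) (by linarith) hFm (fun t ht => ht.2)
  set B := M + Real.log ε⁻¹ + 24 * Real.pi * ε * n with hB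
  have hlogε : 0 ≤ Real.log ε⁻¹ := Real.log_nonneg (by
    rw [one_le_inv₀ hε0]; linarith)
  have hB0 : 0 ≤ B := by have := Real.pi_pos; positivity
  have hlogB : ∀ t, Real.log (f t) ≤ B := fun t => by
    rcases (hf0 t).eq_or_lt with h0 | h0
    · rw [← h0, Real.log_zero]; exact hB0
    · rw [Real.log_le_iff_le_exp h0]
      refine (hremez t).trans ?_
      have h1 : Real.exp B = Real.exp M / ε * Real.exp (12 * Real.pi * (2 * ε) * n) := by
        rw [hB, Real.exp_add, Real.exp_add, Real.exp_log (inv_pos.mpr hε0)]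
        ring_nf
      rw [h1, hA, mul_div_assoc]
      have h2 : 0 < Real.exp M / ε * Real.exp (12 * Real.pi * (2 * ε) * n) := by positivity
      nlinarith
  have hlogf : ∀ t, Real.log (f t) = 2 * Real.log ‖P.eval (circlePoint t)‖ := fun t => by
    rw [hf, Real.log_pow]; norm_num
  have hli : Integrable (fun t => Real.log (f t)) := by
    simp only [hlogf]
    exact (integrable_log_norm_eval_circlePoint P).const_mul 2
  have hl0 : 0 ≤ ∫ t, Real.log (f t) := by
    simp only [hlogf]
    rw [integral_const_mul]
    linarith [integral_log_norm_eval_circlePoint_nonneg hP]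
  have hI1 : ∫ t in E, Real.log (f t) ≤ ε * B := by
    calc _ ≤ ∫ t in E, B := setIntegral_mono hli.integrableOn integrableOn_const hlogB
      _ = volume.real E * B := by rw [setIntegral_const, smul_eq_mul]
      _ ≤ _ := by gcongr
  have hEc : 1 / 2 ≤ volume.real Eᶜ := by
    have h4 : volume.real (Set.univ : Set UnitAddCircle) = 1 := by
      rw [measureReal_def, AddCircle.measure_univ]; simp
    have := measureReal_compl (μ := volume) hEm
    linarith
  have hYlog : Real.log Y ≤ 0 := Real.log_nonpos hY0.le hY1
  -- Integrate log x ≤ x - 1 at x = f exp(-h)/Y. Since log Y ≤ 0 and E^c has measure at least 1/2, a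
  -- term (1/2) log Y remains; this is the source of the factor 2 in the conclusion.
  have hI2 : ∫ t in Eᶜ, Real.log (f t) ≤ J + 1 / 2 * Real.log Y + 1 := by
    have hi2 : IntegrableOn (fun t => f t * W t / Y) Eᶜ := (hfi.div_const Y).integrableOn
    have hi3 : IntegrableOn (fun _ : UnitAddCircle => Real.log Y) Eᶜ := integrableOn_const
    have hi4 : IntegrableOn (fun t => h t + Real.log Y) Eᶜ := hhi.add hi3
    calc _ ≤ ∫ t in Eᶜ, (h t + Real.log Y + f t * W t / Y) := by
          refine integral_mono_ae hli.integrableOn (hi4.add hi2) ?_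
          filter_upwards [ae_restrict_mem hEm.compl,
            ae_restrict_of_ae (ae_eval_circlePoint_ne_zero hP.ne_zero)] with t ht ht0
          have hft : 0 < f t := by rw [hf]; positivity
          have h1 := Real.log_le_sub_one_of_pos
            (show 0 < f t * Real.exp (-h t) / Y by positivity)
          rw [Real.log_div (by positivity) hY0.ne', Real.log_mul hft.ne' (Real.exp_pos _).ne',
            Real.log_exp, ← hWh t ht] at h1
          change Real.log (f t) ≤ h t + Real.log Y + f t * W t / Y
          linarith
      _ = (∫ t in Eᶜ, h t) + volume.real Eᶜ * Real.log Y + (∫ t in Eᶜ, f t * W t) / Y := by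
          rw [integral_add hi4 hi2, integral_add hhi hi3, setIntegral_const,
            smul_eq_mul, integral_div]
      _ ≤ _ := by
          have h1 : ∫ t in Eᶜ, f t * W t ≤ Y :=
            (setIntegral_le_integral hfi (Filter.Eventually.of_forall fun t =>
              mul_nonneg (hf0 t) (hW0 t))).trans hX
          have h2 : (∫ t in Eᶜ, f t * W t) / Y ≤ 1 := (div_le_one hY0).mpr h1
          nlinarith
  have hsplit := integral_add_compl hEm hli
  rw [← Real.le_log_iff_exp_le hY0]
  linarith

-- The integral is not known beforehand to be positive, so, arguing by contradiction, Y is the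
-- larger of the integral and half of the claimed bound.
open Polynomial in
theorem exp_neg_le_integral_norm_sq_mul {n : ℕ} {P : ℂ[X]} (hP : P.Monic)
    (hn : P.natDegree ≤ n) {W h : UnitAddCircle → ℝ} (hWm : Measurable W) (hW0 : ∀ t, 0 ≤ W t)
    (hW1 : ∀ t, W t ≤ 1) {E : Set UnitAddCircle} (hE : IsOpen E) {ε M J : ℝ} (hε0 : 0 < ε)
    (hε : ε ≤ 1 / 64) (hEε : volume.real E ≤ ε) (hM : 0 ≤ M) (hhM : ∀ t ∈ Eᶜ, h t ≤ M)
    (hWh : ∀ t ∈ Eᶜ, W t = Real.exp (-h t)) (hhi : IntegrableOn h Eᶜ)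
    (hJ : ∫ t in Eᶜ, h t ≤ J) (hJ0 : 0 ≤ J) :
    Real.exp (-(2 * (J + 1 + ε * (M + Real.log ε⁻¹ + 24 * Real.pi * ε * n)))) ≤
      ∫ t, ‖P.eval (circlePoint t)‖ ^ 2 * W t := by
  by_contra! hc
  set R := 2 * (J + 1 + ε * (M + Real.log ε⁻¹ + 24 * Real.pi * ε * n)) with hR
  have hR0 : 0 ≤ R := by
    have hlogε : 0 ≤ Real.log ε⁻¹ := Real.log_nonneg (by
      rw [one_le_inv₀ hε0]; linarith)
    have := Real.pi_pos
    positivity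
  have hlt : max (∫ t, ‖P.eval (circlePoint t)‖ ^ 2 * W t) (Real.exp (-R) / 2) < Real.exp (-R) :=
    max_lt hc (by linarith [Real.exp_pos (-R)])
  have := exp_neg_le_of_integral_norm_sq_mul_le hP hn hWm hW0 hW1 hE hε0 hε hEε hM hhM hWh hhi hJ
    (lt_max_of_lt_right (by positivity)) (hlt.le.trans (Real.exp_le_one_iff.mpr (by linarith)))
    (le_max_left _ _)
  linarith

/-! ### The density, and the prediction error in terms of monic polynomials. -/

theorem deepZeroDensity_nonneg (K : Set UnitAddCircle) (p : ℝ) (t : UnitAddCircle) :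
    0 ≤ deepZeroDensity K p t := by
  rw [deepZeroDensity]
  split_ifs
  · exact le_rfl
  · positivity

theorem deepZeroDensity_le_exp {K : Set UnitAddCircle} {p r : ℝ} (hp : 0 ≤ p) {t : UnitAddCircle}
    (ht : Metric.infDist t K ≤ r) : deepZeroDensity K p t ≤ Real.exp (-r ^ (-p)) := by
  rw [deepZeroDensity]
  split_ifs with h
  · positivity
  · have h0 : 0 < Metric.infDist t K := lt_of_le_of_ne Metric.infDist_nonneg (Ne.symm h)
    exact Real.exp_le_exp.mpr (neg_le_neg (Real.rpow_le_rpow_of_nonpos h0 ht (by linarith)))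

theorem deepZeroDensity_le_one (K : Set UnitAddCircle) (p : ℝ) (t : UnitAddCircle) :
    deepZeroDensity K p t ≤ 1 := by
  rw [deepZeroDensity]
  split_ifs
  · exact zero_le_one
  · exact Real.exp_le_one_iff.mpr (neg_nonpos.mpr (Real.rpow_nonneg Metric.infDist_nonneg _))

theorem measurable_deepZeroDensity (K : Set UnitAddCircle) (p : ℝ) :
    Measurable (deepZeroDensity K p) := by
  have hcd : Continuous fun t => Metric.infDist t K := Metric.continuous_infDist_pt K
  exact Measurable.ite (isClosed_eq hcd continuous_const).measurableSet measurable_const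
    (hcd.measurable.pow_const _).neg.exp

theorem integral_deepZeroMeasure (K : Set UnitAddCircle) (p : ℝ) (f : UnitAddCircle → ℝ) :
    ∫ t, f t ∂(deepZeroMeasure K p) = ∫ t, f t * deepZeroDensity K p t := by
  rw [deepZeroMeasure, integral_withDensity_eq_integral_toReal_smul
    (measurable_deepZeroDensity K p).ennreal_ofReal (by simp)]
  refine integral_congr_ae (Filter.Eventually.of_forall fun t => ?_)
  simp only [ENNReal.toReal_ofReal (deepZeroDensity_nonneg K p t), smul_eq_mul]
  ring

open Polynomial in
theorem predictionError_le_sqrt {n : ℕ} {Q : ℂ[X]} (hQ : Q.Monic) (hn : Q.natDegree = n)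
    (ρ : Measure UnitAddCircle) :
    predictionError ρ n ≤ Real.sqrt (∫ t, ‖Q.eval (circlePoint t)‖ ^ 2 ∂ρ) := by
  refine (ciInf_le ⟨0, ?_⟩ (fun j : Fin n => Q.coeff j)).trans_eq ?_
  · rintro _ ⟨q, rfl⟩
    exact Real.sqrt_nonneg _
  · congr 1
    refine integral_congr_ae (Filter.Eventually.of_forall fun t => ?_)
    have h1 : Q.eval (circlePoint t) = (∑ j : Fin n, Q.coeff j * circlePoint t ^ (j : ℕ)) +
        circlePoint t ^ n := by
      rw [eval_eq_sum_range, hn, Finset.sum_range_succ,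
        Fin.sum_univ_eq_sum_range (fun j => Q.coeff j * circlePoint t ^ j) n]
      congr 1
      rw [← hn, coeff_natDegree, hQ.leadingCoeff, one_mul]
    simp only [h1]

open Polynomial in
theorem le_predictionError {n : ℕ} {ρ : Measure UnitAddCircle} {a : ℝ}
    (h : ∀ Q : ℂ[X], Q.Monic → Q.natDegree = n →
      a ≤ Real.sqrt (∫ t, ‖Q.eval (circlePoint t)‖ ^ 2 ∂ρ)) :
    a ≤ predictionError ρ n := by
  refine le_ciInf fun q => ?_
  have hd := degree_sum_fin_lt q
  have h1 := h (X ^ n + ∑ j : Fin n, C (q j) * X ^ (j : ℕ)) (monic_X_pow_add hd)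
    (natDegree_eq_of_degree_eq_some (by rw [degree_add_eq_left_of_degree_lt (by rwa [degree_X_pow]),
      degree_X_pow]))
  refine h1.trans_eq ?_
  congr 1
  refine integral_congr_ae (Filter.Eventually.of_forall fun t => ?_)
  simp only [eval_add, eval_pow, eval_X, eval_finsetSum, eval_mul, eval_C]
  rw [add_comm]

/-! ### Lower bound for the prediction error. -/

theorem exists_forall_exp_neg_le_predictionError {ν p : ℝ} (hν : 0 < ν) (hp : ν / (ν + 1) < p) :
    ∃ C > 0, ∀ n : ℕ, 1 ≤ n →
      Real.exp (-(C * (n : ℝ) ^ ((p - ν / (ν + 1)) / (p + ν / (ν + 1))))) ≤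
        predictionError (deepZeroMeasure (powerSeqSet ν) p) n := by
  have hθ0 : 0 < ν / (ν + 1) := by positivity
  have hK := fun δ hδ => volume_real_infDist_powerSeqSet_lt_le hν (δ := δ) hδ
  set θ := ν / (ν + 1)
  have hp0 : 0 < p := hθ0.trans hp
  have hq : 0 < p + θ := by positivity
  set K := powerSeqSet ν
  have hpi := Real.pi_pos
  set A : ℝ := 8 * 2 ^ θ / (1 - 2 ^ (θ - p)) with hA
  have hA0 : 0 ≤ A := by
    have : (2 : ℝ) ^ (θ - p) < 1 := Real.rpow_lt_one_of_one_lt_of_neg (by norm_num) (by linarith)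
    exact div_nonneg (by positivity) (by linarith)
  -- Chosen so that ε = 8δ^θ ≤ 1/64 for every n ≥ 1.
  set b : ℝ := (1 / 512) ^ (1 / θ) with hb
  have hb0 : 0 < b := by positivity
  have hbθ : b ^ θ = 1 / 512 := by
    rw [hb, ← Real.rpow_mul (by norm_num), one_div_mul_cancel hθ0.ne', Real.rpow_one]
  -- The terms come from ∫ d_K^(-p), from εδ^(-p), from 1 + ε log(1/ε) ≤ 2 and from 24πε²n. The
  -- factor 2 of the Szegő bound is absorbed by the square root in `e_n`.
  refine ⟨(A + 8) * b ^ (θ - p) + 2 + 1536 * Real.pi * (b ^ θ) ^ 2, by positivity, fun n hn => ?_⟩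
  have hn0 : (0 : ℝ) < n := by exact_mod_cast hn
  have hn1 : (1 : ℝ) ≤ n := by exact_mod_cast hn
  set α := (p - θ) / (p + θ) with hα
  have hα0 : 0 < α := div_pos (by linarith) hq
  have hnα : 1 ≤ (n : ℝ) ^ α := Real.one_le_rpow hn1 hα0.le
  set δ : ℝ := b * (n : ℝ) ^ (-(1 / (p + θ))) with hδ
  have hδ0 : 0 < δ := by positivity
  have hδpow : ∀ x : ℝ, δ ^ x = b ^ x * (n : ℝ) ^ (-x / (p + θ)) := fun x => by
    rw [hδ, Real.mul_rpow hb0.le (by positivity), ← Real.rpow_mul hn0.le]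
    congr 2
    ring
  set ε : ℝ := 8 * δ ^ θ with hε
  have hε0 : 0 < ε := by positivity
  have hε64 : ε ≤ 1 / 64 := by
    have h1 : (n : ℝ) ^ (-θ / (p + θ)) ≤ 1 :=
      Real.rpow_le_one_of_one_le_of_nonpos hn1 (div_nonpos_of_nonpos_of_nonneg (by linarith) hq.le)
    rw [hε, hδpow, hbθ]
    linarith
  have h1 : δ ^ (θ - p) = b ^ (θ - p) * (n : ℝ) ^ α := by
    rw [hδpow, hα, neg_sub]
  have h2 : ε * δ ^ (-p) = 8 * (b ^ (θ - p) * (n : ℝ) ^ α) := by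
    rw [← h1, hε, sub_eq_add_neg, Real.rpow_add hδ0]
    ring
  have h3 : ε * ε * n = 64 * (b ^ θ) ^ 2 * (n : ℝ) ^ α := by
    have h4 : (n : ℝ) ^ (-θ / (p + θ)) * (n : ℝ) ^ (-θ / (p + θ)) * n = (n : ℝ) ^ α := by
      nth_rewrite 3 [← Real.rpow_one (n : ℝ)]
      rw [← Real.rpow_add hn0, ← Real.rpow_add hn0, hα]
      congr 1
      field_simp
      ring
    rw [hε, hδpow, ← h4]
    ring
  have h5 : ε * Real.log ε⁻¹ ≤ 1 := by
    have h6 := Real.log_le_sub_one_of_pos (inv_pos.mpr hε0)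
    have h7 : ε * Real.log ε⁻¹ ≤ ε * (ε⁻¹ - 1) := by gcongr
    rw [mul_sub, mul_inv_cancel₀ hε0.ne'] at h7
    linarith
  obtain ⟨hint, hJ⟩ := setIntegral_infDist_rpow_neg_le hp0 hp (by norm_num : (0 : ℝ) ≤ 8)
    (infDist_powerSeqSet_le_half ν) hK hδ0
  have hcd : Continuous fun t => Metric.infDist t K := Metric.continuous_infDist_pt K
  have hcompl : {t | Metric.infDist t K < δ}ᶜ = {t | δ ≤ Metric.infDist t K} := by
    ext t
    simp only [Set.mem_compl_iff, Set.mem_ofPred_eq, not_lt]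
  rw [← hcompl] at hint hJ
  have hge : ∀ t ∈ {t | Metric.infDist t K < δ}ᶜ, δ ≤ Metric.infDist t K := fun t ht => by
    rwa [hcompl] at ht
  refine le_predictionError fun Q hQ hQn => Real.le_sqrt_of_sq_le ?_
  rw [integral_deepZeroMeasure]
  refine le_trans ?_ (exp_neg_le_integral_norm_sq_mul hQ hQn.le (measurable_deepZeroDensity K p)
    (deepZeroDensity_nonneg K p) (deepZeroDensity_le_one K p)
    (isOpen_lt hcd continuous_const) hε0 hε64 (hK δ hδ0) (M := δ ^ (-p)) (by positivity)
    (fun t ht => Real.rpow_le_rpow_of_nonpos hδ0 (hge t ht) (by linarith))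
    (fun t ht => ?_) hint hJ (by positivity))
  · rw [← Real.exp_nat_mul]
    apply Real.exp_le_exp.mpr
    rw [h1]
    have h8 : ε * (δ ^ (-p) + Real.log ε⁻¹ + 24 * Real.pi * ε * n) =
        ε * δ ^ (-p) + ε * Real.log ε⁻¹ + 24 * Real.pi * (ε * ε * n) := by ring
    rw [h8, h2, h3]
    push_cast
    nlinarith
  · have h9 : Metric.infDist t K ≠ 0 := (hδ0.trans_le (hge t ht)).ne'
    rw [deepZeroDensity, if_neg h9]

/-! ### Chebyshev polynomials of an arc. -/

open Polynomial Polynomial.Chebyshev in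
theorem eval_T_eq_prod {N : ℕ} : ∃ S : Finset ℝ, S.card = N ∧
    ∀ y : ℝ, (T ℝ N).eval y = 2 ^ (N - 1) * ∏ x ∈ S, (y - x) := by
  set S := (Finset.range N).image fun k : ℕ => Real.cos ((2 * k + 1) * Real.pi / (2 * N))
  have hr : (T ℝ N).roots = S.val := roots_T_real N
  have hcard : S.card = N := by
    rw [Finset.card_image_of_injOn ((Finset.range N).nodup_map_iff_injOn.mp (roots_T_real_nodup N)),
      Finset.card_range]
  refine ⟨S, hcard, fun y => ?_⟩
  have h1 := C_leadingCoeff_mul_prod_multiset_X_sub_C (p := T ℝ N)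
    (by rw [hr, natDegree_T, Int.natAbs_natCast]; exact hcard)
  rw [hr, leadingCoeff_T, Int.natAbs_natCast] at h1
  have h2 := congrArg (eval y) h1
  rw [← h2, eval_mul, eval_C]
  congr 1
  change eval y (∏ x ∈ S, (X - C x)) = _
  simp [eval_prod]

open Polynomial Polynomial.Chebyshev in
/-- The monic Chebyshev polynomial of an arc: its modulus at angle `φ` from the centre `w` of the
complementary arc. -/
theorem exists_monic_norm_eval_eq {N : ℕ} (hN : 1 ≤ N) {w : ℂ} (hw : ‖w‖ = 1) {s : ℝ}
    (hs : 0 < s) : ∃ Q : ℂ[X], Q.Monic ∧ Q.natDegree = 2 * N ∧ ∀ φ : ℝ,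
      ‖Q.eval (w * Complex.exp (φ * Complex.I))‖ =
        2 * s ^ (2 * N) * |(T ℝ N).eval ((1 + Real.cos φ) / s ^ 2 - 1)| := by
  obtain ⟨S, hS, hT⟩ := eval_T_eq_prod (N := N)
  -- Each root y of T_N is pulled back by φ ↦ (1 + cos φ)/s² - 1. Multiplied by 2s²e^(iφ), the
  -- difference from y becomes a monic quadratic in the point of the circle, up to a unimodular
  -- factor.
  set f : ℝ → ℂ[X] := fun y => X ^ 2 + C (2 * w - (2 * s ^ 2 * (1 + y) : ℝ) * w) * X + C (w ^ 2)
    with hf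
  have hfd : ∀ y, (f y).natDegree = 2 := fun y => by
    simp only [hf]
    compute_degree!
  have hfm : ∀ y, (f y).Monic := fun y => by
    simp only [hf]
    monicity!
  refine ⟨∏ y ∈ S, f y, monic_prod_of_monic _ _ fun y _ => hfm y, ?_, fun φ => ?_⟩
  · rw [natDegree_prod_of_monic _ _ fun y _ => hfm y]
    simp [hfd, hS, mul_comm]
  · have hval : ∀ y, ‖(f y).eval (w * Complex.exp (φ * Complex.I))‖ =
        2 * s ^ 2 * |(1 + Real.cos φ) / s ^ 2 - 1 - y| := fun y => by
      set z := Complex.exp (φ * Complex.I) with hz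
      have hz0 : z ≠ 0 := Complex.exp_ne_zero _
      have hzn : ‖z‖ = 1 := Complex.norm_exp_ofReal_mul_I φ
      have hcos : (2 * Real.cos φ : ℝ) * z = z ^ 2 + 1 := by
        push_cast
        rw [Complex.two_cos, add_mul, neg_mul, Complex.exp_neg, ← hz, inv_mul_cancel₀ hz0, sq]
      have h1 : (f y).eval (w * z) =
          w ^ 2 * z * ((2 * s ^ 2 * ((1 + Real.cos φ) / s ^ 2 - 1 - y) : ℝ) : ℂ) := by
        have h2 : 2 * s ^ 2 * ((1 + Real.cos φ) / s ^ 2 - 1 - y) =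
            2 + 2 * Real.cos φ - 2 * s ^ 2 * (1 + y) := by field_simp; ring
        rw [h2]
        simp only [hf, eval_add, eval_pow, eval_X, eval_mul, eval_C]
        rw [Complex.ofReal_sub, Complex.ofReal_add, Complex.ofReal_ofNat]
        linear_combination (-w ^ 2) * hcos
      rw [h1, norm_mul, norm_mul, norm_pow, hw, hzn, Complex.norm_real, Real.norm_eq_abs, abs_mul,
        abs_of_pos (by positivity : 0 < 2 * s ^ 2)]
      ring
    rw [eval_prod, norm_prod, Finset.prod_congr rfl fun y _ => hval y, Finset.prod_mul_distrib,
      Finset.prod_const, hS, hT, abs_mul, Finset.abs_prod, abs_of_pos (by positivity), mul_pow,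
      ← pow_mul]
    have h2 : (2 : ℝ) ^ N = 2 * 2 ^ (N - 1) := by
      rw [← pow_succ', Nat.sub_add_cancel hN]
    rw [h2]
    ring

open Polynomial Polynomial.Chebyshev in
theorem eval_T_le_pow {N : ℕ} {y : ℝ} (hy : 1 ≤ y) :
    (T ℝ N).eval y ≤ (y + Real.sqrt (y ^ 2 - 1)) ^ N := by
  set r := Real.sqrt (y ^ 2 - 1)
  have hr0 : 0 ≤ r := Real.sqrt_nonneg _
  have hr2 : r ^ 2 = y ^ 2 - 1 := Real.sq_sqrt (by nlinarith)
  have hx : 0 < y + r := by linarith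
  have hyc : y = Real.cosh (Real.log (y + r)) := by
    rw [Real.cosh_log hx]
    have : (y + r)⁻¹ = y - r := by
      rw [inv_eq_one_div, div_eq_iff hx.ne']
      linear_combination hr2
    rw [this]
    ring
  have hu : 0 ≤ Real.log (y + r) := Real.log_nonneg (by linarith)
  conv_lhs => rw [hyc]
  rw [T_real_cosh, Real.cosh_eq]
  have h1 : Real.exp ((N : ℤ) * Real.log (y + r)) = (y + r) ^ N := by
    rw [Int.cast_natCast, Real.exp_nat_mul, Real.exp_log hx]
  have h2 : Real.exp (-((N : ℤ) * Real.log (y + r))) ≤ Real.exp ((N : ℤ) * Real.log (y + r)) := by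
    apply Real.exp_le_exp.mpr
    have : (0 : ℝ) ≤ (N : ℤ) * Real.log (y + r) := by positivity
    linarith
  linarith

-- The extreme case is c = 1, the centre of the omitted arc: there s²y = 1 + σ² and s²√(y²-1) = 2σ,
-- with sum (1 + σ)².
open Polynomial Polynomial.Chebyshev in
theorem pow_mul_abs_eval_T_le {N : ℕ} {s σ c : ℝ} (hs : 0 < s) (hσ : 0 ≤ σ)
    (hsσ : s ^ 2 + σ ^ 2 = 1) (hc : -1 ≤ c) (hc1 : c ≤ 1) :
    s ^ (2 * N) * |(T ℝ N).eval ((1 + c) / s ^ 2 - 1)| ≤ (1 + σ) ^ (2 * N) := by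
  have hs1 : s ^ 2 ≤ 1 := by nlinarith
  set y := (1 + c) / s ^ 2 - 1 with hy
  have hy1 : -1 ≤ y := by
    have : 0 ≤ (1 + c) / s ^ 2 := div_nonneg (by linarith) (by positivity)
    linarith
  rw [pow_mul, pow_mul]
  rcases le_total y 1 with h | h
  · have h1 := abs_eval_T_real_le_one N (abs_le.mpr ⟨hy1, h⟩)
    calc (s ^ 2) ^ N * |(T ℝ N).eval y| ≤ 1 * 1 := by
          gcongr
          exact pow_le_one₀ (by positivity) hs1
      _ ≤ _ := by rw [one_mul]; exact one_le_pow₀ (by nlinarith)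
  · rw [abs_of_nonneg (by linarith [one_le_eval_T_real N h])]
    set r := Real.sqrt (y ^ 2 - 1) with hr
    have hr0 : 0 ≤ r := Real.sqrt_nonneg _
    have hr2 : r ^ 2 = y ^ 2 - 1 := Real.sq_sqrt (by nlinarith)
    have hsy : s ^ 2 * y = 1 + c - s ^ 2 := by rw [hy]; field_simp
    have hsr : s ^ 2 * r ≤ 2 * σ := by
      refine le_of_sq_le_sq ?_ (by positivity)
      have h2 : (s ^ 2 * r) ^ 2 = (1 + c) * (1 + c - 2 * s ^ 2) := by
        rw [mul_pow, hr2]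
        linear_combination (s ^ 2 * y + 1 + c - s ^ 2) * hsy
      have h3 : s ^ 2 ≤ s ^ 2 * y := by nlinarith [sq_nonneg s]
      rw [h2]
      nlinarith
    calc (s ^ 2) ^ N * (T ℝ N).eval y ≤ (s ^ 2) ^ N * (y + r) ^ N := by
          gcongr
          exact eval_T_le_pow h
      _ = (s ^ 2 * y + s ^ 2 * r) ^ N := by rw [← mul_pow, mul_add]
      _ ≤ ((1 + σ) ^ 2) ^ N := by
          have : 0 ≤ y := by linarith
          gcongr
          nlinarith

/-! ### Upper bound for the prediction error. -/

theorem predictionError_le_sqrt_of_forall_le {K : Set UnitAddCircle} {p B : ℝ} {n : ℕ}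
    {Q : Polynomial ℂ} (hQ : Q.Monic) (hn : Q.natDegree = n)
    (hB : ∀ t, ‖Q.eval (circlePoint t)‖ ^ 2 * deepZeroDensity K p t ≤ B) :
    predictionError (deepZeroMeasure K p) n ≤ Real.sqrt B := by
  refine (predictionError_le_sqrt hQ hn _).trans (Real.sqrt_le_sqrt ?_)
  rw [integral_deepZeroMeasure]
  have h4 : volume.real (Set.univ : Set UnitAddCircle) = 1 := by
    rw [measureReal_def, AddCircle.measure_univ]; simp
  calc _ ≤ ∫ _ : UnitAddCircle, B := by
        refine integral_mono_of_nonneg (Filter.Eventually.of_forall fun t =>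
          mul_nonneg (by positivity) (deepZeroDensity_nonneg K p t)) (integrable_const B)
          (Filter.Eventually.of_forall hB)
    _ = B := by rw [integral_const, h4, one_smul]

/-- The test polynomial tⁿ already suffices for small n, because d_K ≤ 1/2. -/
theorem predictionError_powerSeqSet_le_exp_neg_half {ν p : ℝ} (hp : 0 < p) (n : ℕ) :
    predictionError (deepZeroMeasure (powerSeqSet ν) p) n ≤ Real.exp (-(1 / 2)) := by
  have h := predictionError_le_sqrt_of_forall_le (K := powerSeqSet ν) (p := p) (B := Real.exp (-1))
    (Polynomial.monic_X_pow (R := ℂ) n) (Polynomial.natDegree_X_pow n) (fun t => by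
      have h1 : (1 : ℝ) ≤ (1 / 2) ^ (-p) :=
        Real.one_le_rpow_of_pos_of_le_one_of_nonpos (by norm_num) (by norm_num) (by linarith)
      have h2 := deepZeroDensity_le_exp hp.le (infDist_powerSeqSet_le_half ν t)
      have h3 : Real.exp (-(1 / 2) ^ (-p)) ≤ Real.exp (-1) := Real.exp_le_exp.mpr (by linarith)
      simp only [Polynomial.eval_pow, Polynomial.eval_X, norm_pow, norm_circlePoint, one_pow,
        one_mul]
      linarith)
  refine h.trans_eq ?_
  rw [← Real.exp_half]
  norm_num

theorem cos_le_cos_of_le_of_le_two_pi_sub {a φ : ℝ} (ha : 0 ≤ a) (h1 : a ≤ φ)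
    (h2 : φ ≤ 2 * Real.pi - a) : Real.cos φ ≤ Real.cos a := by
  rcases le_total φ Real.pi with h | h
  · exact Real.cos_le_cos_of_nonneg_of_le_pi ha h h1
  · rw [← Real.cos_two_pi_sub φ]
    exact Real.cos_le_cos_of_nonneg_of_le_pi ha (by linarith) (by linarith)

-- The test polynomial is the Chebyshev polynomial with omitted arc [0, ε], centred at ε/2. The
-- first term bounds its square off that arc; the second is its growth on the arc against the
-- weight, which is tiny since K is dense there at scale νε^(1+1/ν).
open Polynomial in
theorem predictionError_powerSeqSet_le_sqrt {ν p : ℝ} (hν : 0 < ν) (hp : 0 < p) {ε : ℝ}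
    (hε0 : 0 < ε) (hε : ε < 1) {n : ℕ} (hn : 2 ≤ n) :
    predictionError (deepZeroMeasure (powerSeqSet ν) p) n ≤
      Real.sqrt (12 * Real.exp (-(n * ε ^ 2)) +
        4 * Real.exp (Real.pi * n * ε - (ν * ε ^ (1 + 1 / ν)) ^ (-p))) := by
  have hpi := Real.pi_pos
  set s := Real.cos (Real.pi * ε / 2) with hs
  set σ := Real.sin (Real.pi * ε / 2) with hσ
  have hs0 : 0 < s := Real.cos_pos_of_mem_Ioo ⟨by nlinarith, by nlinarith⟩
  have hεσ : ε ≤ σ := by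
    have := Real.mul_le_sin (x := Real.pi * ε / 2) (by positivity) (by nlinarith)
    refine le_trans (le_of_eq ?_) this
    field_simp
  have hσle : σ ≤ Real.pi * ε / 2 := Real.sin_le (by positivity)
  have hsσ : s ^ 2 + σ ^ 2 = 1 := Real.cos_sq_add_sin_sq _
  -- The Chebyshev polynomial has even degree 2N, so odd n takes an extra factor X of modulus 1. The
  -- loss from 2N ≥ n - 1 costs at most e ≤ 3, hence 12 = 4·3.
  set N := n / 2 with hN
  have hNn : 2 * N + n % 2 = n := Nat.div_add_mod n 2
  have hN1 : 1 ≤ N := by omega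
  have hn1 : (n : ℝ) - 1 ≤ 2 * N := by
    have : n ≤ 2 * N + 1 := by omega
    have : (n : ℝ) ≤ 2 * N + 1 := by exact_mod_cast this
    linarith
  have hn2 : 2 * (N : ℝ) ≤ n := by
    have : 2 * N ≤ n := by omega
    exact_mod_cast this
  obtain ⟨Q, hQ, hQd, hQv⟩ := exists_monic_norm_eval_eq hN1
    (norm_circlePoint ((ε / 2 : ℝ) : UnitAddCircle)) hs0
  refine predictionError_le_sqrt_of_forall_le (Q := Q * X ^ (n % 2)) (hQ.mul (monic_X_pow _))
    (by rw [hQ.natDegree_mul (monic_X_pow _), hQd, natDegree_X_pow, hNn]) fun t => ?_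
  obtain ⟨θ, ⟨hθ0, hθ1⟩, rfl⟩ : t ∈ ((↑) : ℝ → UnitAddCircle) '' Set.Ico 0 (0 + 1) := by
    rw [AddCircle.coe_image_Ico_eq]; trivial
  rw [zero_add] at hθ1
  set φ : ℝ := 2 * Real.pi * (θ - ε / 2) with hφ
  have hnorm : ‖(Q * X ^ (n % 2)).eval (circlePoint (θ : UnitAddCircle))‖ ^ 2 =
      4 * (s ^ (2 * N) * |(Chebyshev.T ℝ N).eval ((1 + Real.cos φ) / s ^ 2 - 1)|) ^ 2 := by
    have h1 : circlePoint (θ : UnitAddCircle) =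
        circlePoint ((ε / 2 : ℝ) : UnitAddCircle) * Complex.exp (φ * Complex.I) := by
      rw [hφ, ← circlePoint_coe, ← circlePoint_add, ← AddCircle.coe_add, add_sub_cancel]
    rw [eval_mul, eval_pow, eval_X, norm_mul, norm_pow, norm_circlePoint, one_pow, mul_one, h1, hQv]
    ring
  rw [hnorm]
  have hW0 := deepZeroDensity_nonneg (powerSeqSet ν) p θ
  rcases le_or_gt θ ε with h | h
  · have hW := deepZeroDensity_le_exp hp.le (infDist_powerSeqSet_le hν hθ0 h)
    have h1 := pow_mul_abs_eval_T_le (N := N) hs0 (hε0.le.trans hεσ) hsσ (Real.neg_one_le_cos φ)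
      (Real.cos_le_one φ)
    have h2 : (1 + σ) ^ (2 * N) ≤ Real.exp (Real.pi * n * ε / 2) := by
      have h3 : 1 + σ ≤ Real.exp (Real.pi * ε / 2) := by
        linarith [Real.add_one_le_exp (Real.pi * ε / 2)]
      calc (1 + σ) ^ (2 * N) ≤ Real.exp (Real.pi * ε / 2) ^ (2 * N) := by
            gcongr
            linarith
        _ = Real.exp (2 * N * (Real.pi * ε / 2)) := by rw [← Real.exp_nat_mul]; push_cast; rfl
        _ ≤ _ := by
            apply Real.exp_le_exp.mpr
            have : 0 < Real.pi * ε / 2 := by positivity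
            nlinarith
    have h4 : 4 * (s ^ (2 * N) * |(Chebyshev.T ℝ N).eval ((1 + Real.cos φ) / s ^ 2 - 1)|) ^ 2 *
        deepZeroDensity (powerSeqSet ν) p θ ≤
        4 * Real.exp (Real.pi * n * ε / 2) ^ 2 * Real.exp (-(ν * ε ^ (1 + 1 / ν)) ^ (-p)) := by
      gcongr
      exact h1.trans h2
    have h5 : 4 * Real.exp (Real.pi * n * ε / 2) ^ 2 * Real.exp (-(ν * ε ^ (1 + 1 / ν)) ^ (-p)) =
        4 * Real.exp (Real.pi * n * ε - (ν * ε ^ (1 + 1 / ν)) ^ (-p)) := by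
      rw [← Real.exp_nat_mul, mul_assoc, ← Real.exp_add]
      congr 2
      push_cast
      ring
    rw [h5] at h4
    exact h4.trans (le_add_of_nonneg_left (by positivity))
  · have hcos : 1 + Real.cos φ ≤ 2 * s ^ 2 := by
      have h1 := cos_le_cos_of_le_of_le_two_pi_sub (a := Real.pi * ε) (φ := φ) (by positivity)
        (by rw [hφ]; nlinarith) (by rw [hφ]; nlinarith)
      have h2 := Real.cos_two_mul (Real.pi * ε / 2)
      rw [← hs, show 2 * (Real.pi * ε / 2) = Real.pi * ε by ring] at h2
      linarith
    have hT : |(Chebyshev.T ℝ N).eval ((1 + Real.cos φ) / s ^ 2 - 1)| ≤ 1 := by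
      refine Chebyshev.abs_eval_T_real_le_one N (abs_le.mpr ⟨?_, ?_⟩)
      · have : 0 ≤ (1 + Real.cos φ) / s ^ 2 :=
          div_nonneg (by linarith [Real.neg_one_le_cos φ]) (by positivity)
        linarith
      · have : (1 + Real.cos φ) / s ^ 2 ≤ 2 := by rwa [div_le_iff₀ (by positivity)]
        linarith
    have h1 : s ^ 2 ≤ Real.exp (-ε ^ 2) := by
      have := Real.add_one_le_exp (-ε ^ 2)
      nlinarith
    have h2 : (s ^ (2 * N)) ^ 2 ≤ 3 * Real.exp (-(n * ε ^ 2)) := by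
      have h3 : (s ^ (2 * N)) ^ 2 = (s ^ 2) ^ (2 * N) := by ring
      calc (s ^ (2 * N)) ^ 2 ≤ Real.exp (-ε ^ 2) ^ (2 * N) := by rw [h3]; gcongr
        _ = Real.exp (2 * N * (-ε ^ 2)) := by rw [← Real.exp_nat_mul]; push_cast; rfl
        _ ≤ Real.exp (1 + -(n * ε ^ 2)) := by
            apply Real.exp_le_exp.mpr
            nlinarith
        _ = Real.exp 1 * Real.exp (-(n * ε ^ 2)) := Real.exp_add _ _
        _ ≤ _ := by
            gcongr
            linarith [Real.exp_one_lt_d9]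
    have h4 : 4 * (s ^ (2 * N) * |(Chebyshev.T ℝ N).eval ((1 + Real.cos φ) / s ^ 2 - 1)|) ^ 2 *
        deepZeroDensity (powerSeqSet ν) p θ ≤ 4 * (s ^ (2 * N) * 1) ^ 2 * 1 := by
      gcongr
      exact deepZeroDensity_le_one _ _ _
    have h5 : 0 ≤ 4 * Real.exp (Real.pi * n * ε - (ν * ε ^ (1 + 1 / ν)) ^ (-p)) := by positivity
    linarith

theorem exists_forall_predictionError_le_exp_neg {ν p : ℝ} (hν : 0 < ν) (hp : ν / (ν + 1) < p) :
    ∃ c > 0, ∀ n : ℕ, 1 ≤ n →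
      predictionError (deepZeroMeasure (powerSeqSet ν) p) n ≤
        Real.exp (-(c * (n : ℝ) ^ ((p - ν / (ν + 1)) / (p + ν / (ν + 1))))) := by
  have hθ0 : 0 < ν / (ν + 1) := by positivity
  have hθν : 1 + 1 / ν = 1 / (ν / (ν + 1)) := by field_simp
  set θ := ν / (ν + 1)
  have hp0 : 0 < p := hθ0.trans hp
  have hq : 0 < p + θ := by positivity
  have hpi := Real.pi_pos
  have hpi4 := Real.pi_lt_four
  -- Makes the weight exponent on the arc at least 5m with m = n^(p/(p+θ)), which outweighs the
  -- growth πbm ≤ 2m together with b²n^α ≤ m.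
  set β : ℝ := (5 * ν ^ p) ^ (-(θ / p)) with hβ
  have hβ0 : 0 < β := by positivity
  have hβp : β ^ (-(p / θ)) = 5 * ν ^ p := by
    rw [hβ, ← Real.rpow_mul (by positivity)]
    have : -(θ / p) * -(p / θ) = 1 := by field_simp
    rw [this, Real.rpow_one]
  set b : ℝ := min (1 / 2) β with hb
  have hb0 : 0 < b := lt_min (by norm_num) hβ0
  have hb1 : b ≤ 1 / 2 := min_le_left _ _
  have hbp : 5 ≤ ν ^ (-p) * b ^ (-(p / θ)) := by
    have h1 : 5 * ν ^ p ≤ b ^ (-(p / θ)) := by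
      rw [← hβp]
      exact Real.rpow_le_rpow_of_nonpos hb0 (min_le_right _ _) (neg_nonpos.mpr (by positivity))
    calc (5 : ℝ) = ν ^ (-p) * (5 * ν ^ p) := by
          rw [Real.rpow_neg hν.le]; field_simp
      _ ≤ _ := by gcongr
  refine ⟨b ^ 2 / 12, by positivity, fun n hn => ?_⟩
  have hn0 : (0 : ℝ) < n := by exact_mod_cast hn
  have hn1 : (1 : ℝ) ≤ n := by exact_mod_cast hn
  set α := (p - θ) / (p + θ) with hα
  have hnα0 : 0 < (n : ℝ) ^ α := by positivity
  have hhalf := predictionError_powerSeqSet_le_exp_neg_half (ν := ν) hp0 n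
  -- If b²n^α ≤ 6, the bound exp(-1/2) suffices because c = b²/12; this includes n = 1.
  rcases le_total (b ^ 2 * (n : ℝ) ^ α) 6 with hx | hx
  · exact hhalf.trans (Real.exp_le_exp.mpr (by linarith))
  have hn2 : 2 ≤ n := by
    by_contra hc
    have : n = 1 := by omega
    rw [this, Nat.cast_one, Real.one_rpow] at hx
    have := pow_le_one₀ hb0.le (hb1.trans (by norm_num)) (n := 2)
    linarith
  set ε : ℝ := b * (n : ℝ) ^ (-(θ / (p + θ))) with hε
  have hε0 : 0 < ε := by positivity
  have hε1 : ε < 1 := by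
    have h1 : (n : ℝ) ^ (-(θ / (p + θ))) ≤ 1 :=
      Real.rpow_le_one_of_one_le_of_nonpos hn1 (neg_nonpos.mpr (by positivity))
    nlinarith
  have h1 : n * ε ^ 2 = b ^ 2 * (n : ℝ) ^ α := by
    have h2 : (n : ℝ) * ((n : ℝ) ^ (-(θ / (p + θ))) * (n : ℝ) ^ (-(θ / (p + θ)))) =
        (n : ℝ) ^ α := by
      nth_rewrite 1 [← Real.rpow_one (n : ℝ)]
      rw [← Real.rpow_add hn0, ← Real.rpow_add hn0, hα]
      congr 1
      field_simp
      ring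
    rw [hε, ← h2]
    ring
  have h3 : n * ε = b * (n : ℝ) ^ (p / (p + θ)) := by
    have h2 : (n : ℝ) * (n : ℝ) ^ (-(θ / (p + θ))) = (n : ℝ) ^ (p / (p + θ)) := by
      nth_rewrite 1 [← Real.rpow_one (n : ℝ)]
      rw [← Real.rpow_add hn0]
      congr 1
      field_simp
      ring
    rw [hε, ← h2]
    ring
  have h4 : (ν * ε ^ (1 + 1 / ν)) ^ (-p) =
      ν ^ (-p) * b ^ (-(p / θ)) * (n : ℝ) ^ (p / (p + θ)) := by
    rw [hθν, Real.mul_rpow hν.le (by positivity), ← Real.rpow_mul hε0.le, hε,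
      Real.mul_rpow hb0.le (by positivity), ← Real.rpow_mul hn0.le, mul_assoc]
    congr 3
    · ring
    · field_simp
  have h5 : (n : ℝ) ^ α ≤ (n : ℝ) ^ (p / (p + θ)) := by
    apply Real.rpow_le_rpow_of_exponent_le hn1
    rw [hα]
    gcongr
    linarith
  have h6 := predictionError_powerSeqSet_le_sqrt hν hp0 hε0 hε1 hn2
  refine h6.trans (Real.sqrt_le_iff.mpr ⟨(Real.exp_pos _).le, ?_⟩)
  set m := (n : ℝ) ^ (p / (p + θ)) with hm
  have h7 : Real.pi * n * ε - (ν * ε ^ (1 + 1 / ν)) ^ (-p) ≤ -(b ^ 2 * (n : ℝ) ^ α) := by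
    have h8 : Real.pi * n * ε = Real.pi * b * m := by rw [mul_assoc, h3, mul_assoc]
    rw [h8, h4]
    have h9 : 0 < m := by positivity
    have h10 : Real.pi * b * m ≤ 4 * (1 / 2) * m := by gcongr
    have h11 : b ^ 2 * (n : ℝ) ^ α ≤ 1 * m := by
      gcongr
      exact pow_le_one₀ hb0.le (by linarith)
    have h12 : 5 * m ≤ ν ^ (-p) * b ^ (-(p / θ)) * m := by gcongr
    linarith
  rw [h1]
  set x := b ^ 2 * (n : ℝ) ^ α with hxdef
  have h13 := Real.exp_le_exp.mpr h7
  have h14 : Real.exp (-(b ^ 2 / 12 * (n : ℝ) ^ α)) ^ 2 =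
      Real.exp (5 / 6 * x) * Real.exp (-x) := by
    rw [← Real.exp_nat_mul, ← Real.exp_add]
    congr 1
    rw [hxdef]
    push_cast
    ring
  -- Both terms under the root are now multiples of exp(-x), 16 exp(-x) in total. As x ≥ 6, part of
  -- the exponent absorbs the 16 and exp(-x/6) remains.
  have h15 : 16 ≤ Real.exp (5 / 6 * x) := by
    have h16 : Real.exp 5 ≤ Real.exp (5 / 6 * x) := Real.exp_le_exp.mpr (by linarith)
    have h17 : Real.exp 5 = Real.exp 1 ^ 5 := by rw [← Real.exp_nat_mul]; norm_num
    have h18 : (2 : ℝ) ^ 5 ≤ Real.exp 1 ^ 5 := by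
      gcongr
      linarith [Real.exp_one_gt_d9]
    rw [h17] at h16
    norm_num at h18
    linarith
  rw [h14]
  linarith [mul_le_mul_of_nonneg_right h15 (Real.exp_pos (-x)).le]

theorem mainTheorem6 (ν p : ℝ) (hν : 0 < ν) (hp : ν / (ν + 1) < p) :
    ∃ c C : ℝ, 0 < c ∧ 0 < C ∧ ∀ n : ℕ, 1 ≤ n →
      c * (n : ℝ) ^ ((p - ν / (ν + 1)) / (p + ν / (ν + 1))) ≤
          |Real.log (predictionError (deepZeroMeasure (powerSeqSet ν) p) n)| ∧
        |Real.log (predictionError (deepZeroMeasure (powerSeqSet ν) p) n)| ≤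
          C * (n : ℝ) ^ ((p - ν / (ν + 1)) / (p + ν / (ν + 1))) := by
  obtain ⟨c, hc, hcn⟩ := exists_forall_predictionError_le_exp_neg hν hp
  obtain ⟨C, hC, hCn⟩ := exists_forall_exp_neg_le_predictionError hν hp
  refine ⟨c, C, hc, hC, fun n hn => ?_⟩
  have hpos := (Real.exp_pos _).trans_le (hCn n hn)
  have h1 := (Real.log_le_iff_le_exp hpos).mpr (hcn n hn)
  have h2 := (Real.le_log_iff_exp_le hpos).mpr (hCn n hn)
  have h3 : 0 ≤ c * (n : ℝ) ^ ((p - ν / (ν + 1)) / (p + ν / (ν + 1))) := by positivity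
  rw [abs_of_nonpos (by linarith)]
  exact ⟨by linarith, by linarith⟩
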